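/- **Setting.** Let $K$ be a unital commutative $\mathbb Q$-algebra, $z=(z_1,\dots,z_n)$ either noncommutative free variables or commuting variables, and $K\langle\langle z\rangle\rangle$ the algebra of formal power series in $z$ over $K$. For $\vec v\in K\langle\langle z\rangle\rangle^{\times n}$ let $[\vec v\,\partial/\partial z]$ be the $K$-derivation with $z_i\mapsto v_i$. Let $w=(w_1,\dots,w_n)$ be a second family of such variables and put $$B_+\big([\vec v_1\tfrac{\partial}{\partial z}],\dots,[\vec v_m\tfrac{\partial}{\partial z}]\big)\,u(z):=[\vec v_1(w)\tfrac{\partial}{\partial z}]\cdots[\vec v_m(w)\tfrac{\partial}{\partial z}]\,u(z)\Big|_{w=z}$$ (the derivations on the right kill $w$; for $m=0$ this is the identity). For $\alpha\ge 1$ let $\mathcal Der^{[\alpha]}\langle\langle z\rangle\rangle$ be the Lie algebra of the $K$-derivations of $K\langle\langle z\rangle\rangle$ that increase the degree in $z$ by at least $\alpha-1$, let $U^{[\alpha]}$ be its universal enveloping algebra with its usual Hopf algebra structure, and let $\mathcal D^{[\alpha]}\langle\langle z\rangle\rangle$ be the unital subalgebra of $\mathrm{End}_K(K\langle\langle z\rangle\rangle)$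 generated by $\mathcal Der^{[\alpha]}\langle\langle z\rangle\rangle$, i.e. the image of the canonical algebra map $\pi:U^{[\alpha]}\to\mathrm{End}_K(K\langle\langle z\rangle\rangle)$. Let $\emptyset\ne W\subseteq\mathbb N^+$, and let $F_t(z)=z-H_t(z)$ be an automorphism of $K[[t]]\langle\langle z\rangle\rangle$ over $K[[t]]$ with $o(H_t)\ge\alpha$, $H_{t=0}=0$ and $H_t(z)=\sum_{m\in W}t^mH_{[m]}(z)$, where $H_{[m]}\in K\langle\langle z\rangle\rangle^{\times n}$. Let $\mathcal H_{GL}^W$ be the Grossman–Larson Hopf algebra: the free $K$-module on the isomorphism classes of rooted trees $T=B_+(T_1,\dots,T_m)$, $m\ge 0$, where the $T_i$ are $W$-labelled rooted trees whose roots are joined to a new root labelled $0$. The product $T\cdot S$ is the sum of all trees obtained by connecting the roots of $T_1,\dots,T_m$ to vertices of $S$ in all possible ways. The unit is the singleton. The coproduct is $\Delta(T)=\sum_{I\sqcup J=\{1,\dots,m\}}B_+(T_I)\otimes B_+(T_J)$. The counit is $1$ on the singleton and $0$ on all other trees. For a $W$-labelled rooted tree $T$ with root labelled $m$ and branches $T_1,\dots,T_d$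 at the root ($d\ge0$) define recursively $$P_T:=B_+\big([P_{T_1}\tfrac{\partial}{\partial z}],\dots,[P_{T_d}\tfrac{\partial}{\partial z}]\big)H_{[m]},$$ so that $P_T=H_{[m]}$ if $d=0$. For $T=B_+(T_1,\dots,T_m)$ put $$D_T:=B_+\big([P_{T_1}\tfrac{\partial}{\partial z}],\dots,[P_{T_m}\tfrac{\partial}{\partial z}]\big),\qquad D_\circ=\mathrm{id}.$$ **Theorem.** Every $D_T$ lies in $\mathcal D^{[\alpha]}\langle\langle z\rangle\rangle$ and depends only on the isomorphism class of $T$, and the $K$-linear map $\mathcal A_{F_t}:\mathcal H_{GL}^W\to\mathcal D^{[\alpha]}\langle\langle z\rangle\rangle$, $T\mapsto D_T$, is a homomorphism of $K$-Hopf algebras, in the following sense. 1. $\mathcal A_{F_t}$ is a homomorphism of unital $K$-algebras. 2. $\mathcal A_{F_t}=\pi\circ\hat{\mathcal A}$ for a homomorphism of Hopf algebras $\hat{\mathcal A}:\mathcal H_{GL}^W\to U^{[\alpha]}$. 3. For all $x\in\mathcal H_{GL}^W$ one has $\mathcal A_{F_t}(x)\cdot 1=\epsilon(x)$ in $K\langle\langle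 z\rangle\rangle$. If $\Delta'$ is a homomorphism of unital $K$-algebras $\mathcal D^{[\alpha]}\langle\langle z\rangle\rangle\to\mathcal D^{[\alpha]}\langle\langle z\rangle\rangle\otimes_K\mathcal D^{[\alpha]}\langle\langle z\rangle\rangle$ with $\Delta'(\delta)=1\otimes\delta+\delta\otimes1$ for all $\delta\in\mathcal Der^{[\alpha]}\langle\langle z\rangle\rangle$, then $\Delta'\circ\mathcal A_{F_t}=(\mathcal A_{F_t}\otimes\mathcal A_{F_t})\circ\Delta$. If $S'$ is a unital $K$-linear anti-endomorphism of $\mathcal D^{[\alpha]}\langle\langle z\rangle\rangle$ with $S'(\delta)=-\delta$ for all such $\delta$, then $\mathcal A_{F_t}\circ S=S'\circ\mathcal A_{F_t}$, where $S$ is the antipode of $\mathcal H_{GL}^W$. -/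

import Mathlib

open scoped TensorProduct

/-! Labelled rooted forests and the Grossman-Larson Hopf algebra. -/

/-- Plane (ordered) rooted forests with vertices labelled in `W`: either empty, or a first tree,
whose root carries the label `a` and whose branches at the root form the forest `F`,
followed by the remaining forest `G`. -/
inductive PlaneForest (W : Type*) : Type _
  | nil : PlaneForest W
  | cons (a : W) (F G : PlaneForest W) : PlaneForest W

namespace PlaneForest
variable {W : Type*}

/-- Isomorphism of labelled rooted forests: two plane forests represent isomorphic forests
iff one is obtained from the other by reordering the trees of the forest and
the branches at the vertices. -/
inductive Iso : PlaneForest W → PlaneForest W → Prop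
  | nil : Iso nil nil
  | cons (a : W) {F F' G G' : PlaneForest W} : Iso F F' → Iso G G' → Iso (cons a F G) (cons a F' G')
  | swap (a b : W) (F F' G : PlaneForest W) :
      Iso (cons a F (cons b F' G)) (cons b F' (cons a F G))
  | trans {F G H : PlaneForest W} : Iso F G → Iso G H → Iso F H

theorem Iso.refl : ∀ F : PlaneForest W, Iso F F
  | .nil => .nil
  | .cons a F G => .cons a (Iso.refl F) (Iso.refl G)

theorem Iso.symm {F G : PlaneForest W} (h : Iso F G) : Iso G F := by
  induction h with
  | nil => exact .nil
  | cons a _ _ h₁ h₂ => exact .cons a h₁ h₂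
  | swap a b F F' G => exact .swap b a F' F G
  | trans _ _ h₁ h₂ => exact .trans h₂ h₁

instance setoid (W : Type*) : Setoid (PlaneForest W) := ⟨Iso, Iso.refl, Iso.symm, Iso.trans⟩

/-- All ways (with multiplicity) of distributing the trees of a forest `T_1, ..., T_m` into two
forests: the pairs `(T_I, T_J)` with `I ⊔ J = {1, ..., m}`. -/
def split : PlaneForest W → Multiset (PlaneForest W × PlaneForest W)
  | nil => {(nil, nil)}
  | cons a F G => (split G).map (fun p => (cons a F p.1, p.2)) +
      (split G).map (fun p => (p.1, cons a F p.2))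

/-- The number of trees of a forest. -/
def width : PlaneForest W → ℕ
  | nil => 0
  | cons _ _ G => width G + 1

end PlaneForest

/-- Isomorphism classes of `W`-labelled rooted forests. A forest `F` also stands for
the rooted tree `B_+(F)`, whose (unlabelled, i.e. labelled by 0) root carries the trees of `F`. -/
def Forest (W : Type*) : Type _ := Quotient (PlaneForest.setoid W)

namespace Forest
variable {W : Type*}

/-- The isomorphism class of a plane forest. -/
def mk (F : PlaneForest W) : Forest W := Quotient.mk _ F
/-- The empty forest; as a tree `B_+(∅)`, the singleton. -/
def nil : Forest W := mk .nil
/-- The forest consisting of the tree with root labelled `a` and branches `F`, and of the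
trees of `G`. -/
def cons (a : W) : Forest W → Forest W → Forest W :=
  Quotient.map₂ (PlaneForest.cons a) fun _ _ h _ _ h' => PlaneForest.Iso.cons a h h'

theorem cons_swap (a b : W) (F F' G : Forest W) :
    cons a F (cons b F' G) = cons b F' (cons a F G) := by
  induction F using Quotient.ind
  induction F' using Quotient.ind
  induction G using Quotient.ind
  exact Quotient.sound (PlaneForest.Iso.swap _ _ _ _ _)

theorem ind {p : Forest W → Prop} (h0 : p nil) (h1 : ∀ a F G, p F → p G → p (cons a F G)) :
    ∀ F, p F := by
  intro F
  induction F using Quotient.ind with | _ F =>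
  induction F with
  | nil => exact h0
  | cons a F G hF hG => exact h1 a _ _ hF hG

/-- All pairs `(T_I, T_J)`, `I ⊔ J = {1, ..., m}`, for a forest `T_1, ..., T_m`. -/
def split : Forest W → Multiset (Forest W × Forest W) :=
  Quotient.lift (fun F => (PlaneForest.split F).map (Prod.map mk mk)) <| by
    intro F G h
    change PlaneForest.Iso F G at h
    induction h with
    | nil => rfl
    | @cons a F F' G G' h₁ _ _ ih =>
      have e : mk F = mk F' := Quotient.sound h₁
      have key : ∀ (F G : PlaneForest W), (PlaneForest.split (.cons a F G)).map (Prod.map mk mk) =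
          ((PlaneForest.split G).map (Prod.map mk mk)).map (fun p => (cons a (mk F) p.1, p.2)) +
          ((PlaneForest.split G).map (Prod.map mk mk)).map (fun p => (p.1, cons a (mk F) p.2)) := by
        intro F G
        simp only [PlaneForest.split, Multiset.map_add, Multiset.map_map]; rfl
      rw [key, key, e]
      exact congrArg (fun s => s.map (fun p => (cons a (mk F') p.1, p.2)) +
        s.map (fun p => (p.1, cons a (mk F') p.2))) ih
    | swap a b F F' G =>
      have e : ∀ X, mk (.cons a F (.cons b F' X)) = mk (.cons b F' (.cons a F X)) := fun X =>
        Quotient.sound (PlaneForest.Iso.swap _ _ _ _ _)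
      simp only [PlaneForest.split, Multiset.map_add, Multiset.map_map, Function.comp_def, Prod.map, e]
      abel
    | trans _ _ h₁ h₂ => exact h₁.trans h₂

theorem split_nil : split (nil : Forest W) = {(nil, nil)} := by
  change (PlaneForest.split .nil).map (Prod.map mk mk) = _
  simp [PlaneForest.split, nil]

theorem split_cons (a : W) (F G : Forest W) : split (cons a F G) =
    (split G).map (fun p => (cons a F p.1, p.2)) + (split G).map (fun p => (p.1, cons a F p.2)) := by
  induction F using Quotient.ind
  induction G using Quotient.ind
  change Multiset.map _ _ = Multiset.map _ (Multiset.map _ _) + Multiset.map _ (Multiset.map _ _)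
  simp only [PlaneForest.split, Multiset.map_add, Multiset.map_map]; rfl

theorem split_swap (F : Forest W) : (split F).map Prod.swap = split F := by
  induction F using ind with
  | h0 => simp [split_nil]
  | h1 a F G _ ih =>
    rw [split_cons, Multiset.map_add, Multiset.map_map, Multiset.map_map, add_comm]
    conv_rhs => rw [← ih, Multiset.map_map, Multiset.map_map]
    rfl

theorem bind_swap {β : Type*} (F : Forest W) (f : Forest W → Forest W → Multiset β) :
    ((split F).bind fun p => f p.1 p.2) = (split F).bind fun p => f p.2 p.1 := by
  conv_lhs => rw [← split_swap, Multiset.bind_map]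
  rfl

theorem bind_coassoc {β : Type*} (F : Forest W)
    (f : Forest W → Forest W → Forest W → Multiset β) :
    ((split F).bind fun p => (split p.1).bind fun q => f q.1 q.2 p.2) =
      (split F).bind fun p => (split p.2).bind fun q => f p.1 q.1 q.2 := by
  induction F using ind generalizing f with
  | h0 => simp [split_nil]
  | h1 a F G _ ih =>
    simp only [split_cons, Multiset.add_bind, Multiset.bind_map, Multiset.bind_add]
    rw [ih (fun x y z => f (cons a F x) y z), ih (fun x y z => f x (cons a F y) z),
      ih (fun x y z => f x y (cons a F z)), add_assoc]

theorem bind_swap12 {β : Type*} (F : Forest W)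
    (f : Forest W → Forest W → Forest W → Multiset β) :
    ((split F).bind fun p => (split p.2).bind fun q => f p.1 q.1 q.2) =
      (split F).bind fun p => (split p.2).bind fun q => f q.1 p.1 q.2 := by
  rw [← bind_coassoc, ← bind_coassoc F (fun x y z => f y x z)]
  refine Multiset.bind_congr fun p _ => ?_
  rw [bind_swap p.1 (fun x y => f x y p.2)]

/-- The multiset of all trees obtained from the tree `B_+(S)` by connecting the roots of the trees
of the forest `x` to vertices of `B_+(S)` in all possible ways (trees `B_+(..)` are recorded by
the forest below the root). If `S` is empty, there is only the root to connect to.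
If `S` has a first tree (root label `a`, branches `F`) and further trees `G`, one chooses which
part `p.1` of `x` goes to vertices of the first tree and which part `p.2` goes to the
root of `B_+(S)` or to vertices of `G`; the root labelled `a` of the first tree plays the role of
the root of `B_+(F)`, and the root of `B_+(S)` that of the root of `B_+(G)`. -/
def graftP : Forest W → PlaneForest W → Multiset (Forest W)
  | x, .nil => {x}
  | x, .cons a F G => (split x).bind fun p =>
      (graftP p.1 F).bind fun X => (graftP p.2 G).map fun Y => cons a X Y

/-- The multiset of all ways to connect the trees of `x` to vertices of `B_+(S)`, as a function of
the isomorphism class of `S`. -/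
def graft (x : Forest W) : Forest W → Multiset (Forest W) :=
  Quotient.lift (graftP x) <| by
    intro F G h
    change PlaneForest.Iso F G at h
    induction h generalizing x with
    | nil => rfl
    | cons a _ _ h₁ h₂ => simp only [graftP, h₁, h₂]
    | swap a b F F' G =>
      simp only [graftP, Multiset.map_bind, Multiset.map_map, Function.comp_def]
      have : ∀ p : Forest W × Forest W, ∀ (F F' : PlaneForest W) (a b : W),
        ((graftP p.1 F).bind fun X => (split p.2).bind fun q => (graftP q.1 F').bind fun X' =>
          (graftP q.2 G).map fun Y => cons a X (cons b X' Y)) =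
        (split p.2).bind fun q => (graftP p.1 F).bind fun X =>  (graftP q.1 F').bind fun X' =>
          (graftP q.2 G).map fun Y => cons a X (cons b X' Y) := fun p F F' a b =>
            Multiset.bind_bind _ _
      simp only [this]
      rw [bind_swap12 x (fun u v w => (graftP u F).bind fun X =>  (graftP v F').bind fun X' =>
          (graftP w G).map fun Y => cons a X (cons b X' Y))]
      refine Multiset.bind_congr fun p _ => Multiset.bind_congr fun q _ => ?_
      rw [Multiset.bind_bind]
      simp only [cons_swap a b]
    | trans _ _ h₁ h₂ => exact (h₁ x).trans (h₂ x)

theorem graft_nil (x : Forest W) : graft x nil = {x} := rfl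

theorem graft_cons (x : Forest W) (a : W) (F G : Forest W) : graft x (cons a F G) =
    (split x).bind fun p => (graft p.1 F).bind fun X => (graft p.2 G).map fun Y => cons a X Y := by
  induction F using Quotient.ind
  induction G using Quotient.ind
  rfl

theorem nil_graft (x : Forest W) : graft nil x = {x} := by
  induction x using ind with
  | h0 => rfl
  | h1 a F G hF hG => simp [graft_cons, split_nil, hF, hG]

theorem split_graft {β : Type*} (x y : Forest W) (f : Forest W → Forest W → Multiset β) :
    ((graft x y).bind fun z => (split z).bind fun q => f q.1 q.2) =
      (split x).bind fun p => (split y).bind fun q => (graft p.1 q.1).bind fun X =>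
        (graft p.2 q.2).bind fun Y => f X Y := by
  induction y using ind generalizing x f with
  | h0 => simp [graft_nil, split_nil]
  | h1 a F G _ ih =>
    simp only [split_cons, Multiset.add_bind, Multiset.bind_map, Multiset.bind_add, graft_cons,
      Multiset.bind_assoc]
    have ih1 := fun (p : Forest W × Forest W) (X : Forest W) =>
      ih p.2 (fun u v => f (cons a X u) v)
    have ih2 := fun (p : Forest W × Forest W) (X : Forest W) =>
      ih p.2 (fun u v => f u (cons a X v))
    simp only [ih1, ih2]
    congr 1
    · have e : ∀ p : Forest W × Forest W, ((graft p.1 F).bind fun X => (split p.2).bind fun r =>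
          (split G).bind fun q => (graft r.1 q.1).bind fun Y => (graft r.2 q.2).bind fun Z =>
            f (cons a X Y) Z) = (split p.2).bind fun r => (graft p.1 F).bind fun X =>
          (split G).bind fun q => (graft r.1 q.1).bind fun Y => (graft r.2 q.2).bind fun Z =>
            f (cons a X Y) Z := fun p => Multiset.bind_bind _ _
      simp only [e]
      rw [← bind_coassoc x (fun u v w => (graft u F).bind fun X =>
          (split G).bind fun q => (graft v q.1).bind fun Y => (graft w q.2).bind fun Z =>
            f (cons a X Y) Z)]
      refine Multiset.bind_congr fun p _ => ?_
      conv_rhs => rw [Multiset.bind_bind]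
      refine Multiset.bind_congr fun q _ => ?_
      rw [Multiset.bind_bind]
    · have e : ∀ p : Forest W × Forest W, ((graft p.1 F).bind fun X => (split p.2).bind fun r =>
          (split G).bind fun q => (graft r.1 q.1).bind fun Y => (graft r.2 q.2).bind fun Z =>
            f Y (cons a X Z)) = (split p.2).bind fun r => (graft p.1 F).bind fun X =>
          (split G).bind fun q => (graft r.1 q.1).bind fun Y => (graft r.2 q.2).bind fun Z =>
            f Y (cons a X Z) := fun p => Multiset.bind_bind _ _
      simp only [e]
      rw [bind_swap12 x (fun u v w => (graft u F).bind fun X =>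
          (split G).bind fun q => (graft v q.1).bind fun Y => (graft w q.2).bind fun Z =>
            f Y (cons a X Z))]
      refine Multiset.bind_congr fun p _ => ?_
      have e2 : ∀ r : Forest W × Forest W, ((graft r.1 F).bind fun X =>
          (split G).bind fun q => (graft p.1 q.1).bind fun Y => (graft r.2 q.2).bind fun Z =>
            f Y (cons a X Z)) = (split G).bind fun q => (graft p.1 q.1).bind fun Y =>
          (graft r.1 F).bind fun X => (graft r.2 q.2).bind fun Z => f Y (cons a X Z) := by
        intro r
        rw [Multiset.bind_bind]
        refine Multiset.bind_congr fun q _ => ?_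
        rw [Multiset.bind_bind]
      simp only [e2]
      rw [Multiset.bind_bind]
      refine Multiset.bind_congr fun q _ => ?_
      rw [Multiset.bind_bind]

theorem graft_assoc (x y z : Forest W) :
    ((graft x y).bind fun w => graft w z) = (graft y z).bind fun w => graft x w := by
  induction z using ind generalizing x y with
  | h0 => 
    simp only [graft_nil, Multiset.singleton_bind]
    exact (Multiset.bind_singleton (graft x y) id).trans (Multiset.map_id _)
  | h1 a F G hF hG =>
    simp only [graft_cons, Multiset.bind_assoc, Multiset.bind_map]
    rw [split_graft x y (fun u v => (graft u F).bind fun X => (graft v G).map fun Y => cons a X Y)]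
    rw [Multiset.bind_bind]
    refine Multiset.bind_congr fun p _ => ?_
    have e1 : ∀ r : Forest W × Forest W, ((graft r.1 p.1).bind fun u => (graft r.2 p.2).bind
        fun v => (graft u F).bind fun X => (graft v G).map fun Y => cons a X Y) =
        (graft p.1 F).bind fun X => (graft p.2 G).bind fun Y =>
          (graft r.1 X).bind fun U => (graft r.2 Y).map fun V => cons a U V := by
      intro r
      have e2 : ∀ u : Forest W, ((graft r.2 p.2).bind
        fun v => (graft u F).bind fun X => (graft v G).map fun Y => cons a X Y) =
        (graft u F).bind fun X => ((graft r.2 p.2).bind fun v => graft v G).map fun Y =>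
          cons a X Y := by
        intro u
        rw [Multiset.bind_bind]
        simp only [Multiset.map_bind]
      simp only [e2]
      rw [← Multiset.bind_assoc, hF, hG, Multiset.bind_assoc]
      refine Multiset.bind_congr fun X _ => ?_
      simp only [Multiset.map_bind]
      rw [Multiset.bind_bind]
    simp only [e1]
    rw [Multiset.bind_bind]
    refine Multiset.bind_congr fun X _ => ?_
    rw [Multiset.bind_bind]

/-- The number of trees of a forest. -/
def width : Forest W → ℕ :=
  Quotient.lift PlaneForest.width <| by
    intro F G h
    change PlaneForest.Iso F G at h
    induction h with
    | nil => rfl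
    | cons a _ _ _ ih => simpa [PlaneForest.width] using ih
    | swap a b F F' G => rfl
    | trans _ _ h₁ h₂ => exact h₁.trans h₂

theorem width_nil : width (nil : Forest W) = 0 := rfl

theorem width_cons (a : W) (F G : Forest W) : width (cons a F G) = width G + 1 := by
  induction F using Quotient.ind
  induction G using Quotient.ind
  rfl

theorem eq_nil_of_width (F : Forest W) (h : width F = 0) : F = nil := by
  induction F using ind with
  | h0 => rfl
  | h1 a F G _ _ => simp [width_cons] at h

theorem width_split (x : Forest W) : ∀ p ∈ split x, width p.1 + width p.2 = width x := by
  induction x using ind with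
  | h0 => simp [split_nil, width_nil]
  | h1 a F G _ ih =>
    intro p hp
    rw [split_cons, Multiset.mem_add, Multiset.mem_map, Multiset.mem_map] at hp
    rcases hp with ⟨q, hq, rfl⟩ | ⟨q, hq, rfl⟩ <;>
      · have := ih q hq
        simp only [width_cons]
        omega

theorem sum_coassoc {M : Type*} [AddCommMonoid M] (F : Forest W)
    (f : Forest W → Forest W → Forest W → M) :
    ((split F).map fun p => ((split p.1).map fun q => f q.1 q.2 p.2).sum).sum =
      ((split F).map fun p => ((split p.2).map fun q => f p.1 q.1 q.2).sum).sum := by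
  have := congrArg Multiset.sum (bind_coassoc F fun x y z => ({f x y z} : Multiset M))
  simpa only [Multiset.sum_bind, Multiset.bind_singleton] using this

theorem sum_split_graft {M : Type*} [AddCommMonoid M] (x y : Forest W)
    (f : Forest W → Forest W → M) :
    ((graft x y).map fun z => ((split z).map fun q => f q.1 q.2).sum).sum =
      ((split x).map fun p => ((split y).map fun q => ((graft p.1 q.1).map fun X =>
        ((graft p.2 q.2).map fun Y => f X Y).sum).sum).sum).sum := by
  have := congrArg Multiset.sum (split_graft x y fun x y => ({f x y} : Multiset M))
  simpa only [Multiset.sum_bind, Multiset.bind_singleton] using this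

theorem sum_counit {M : Type*} [AddCommMonoid M] (x : Forest W) (f : Forest W → M) :
    ((split x).map fun p => if p.1.width = 0 then f p.2 else 0).sum = f x := by
  induction x using ind generalizing f with
  | h0 => simp [split_nil, width_nil]
  | h1 a F G _ ih =>
    rw [split_cons, Multiset.map_add, Multiset.map_map, Multiset.map_map, Multiset.sum_add]
    simp only [Function.comp_def, width_cons]
    rw [ih fun p => f (cons a F p)]
    simp

theorem sum_swap {M : Type*} [AddCommMonoid M] (x : Forest W) (f : Forest W → Forest W → M) :
    ((split x).map fun p => f p.1 p.2).sum = ((split x).map fun p => f p.2 p.1).sum := by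
  conv_lhs => rw [← split_swap, Multiset.map_map]
  rfl

theorem width_graft (x y : Forest W) : ∀ z ∈ graft x y,
    z.width = 0 ↔ x.width = 0 ∧ y.width = 0 := by
  induction y using ind with
  | h0 => simp [graft_nil, width_nil]
  | h1 a F G _ _ =>
    intro z hz
    simp only [graft_cons, Multiset.mem_bind, Multiset.mem_map] at hz
    obtain ⟨p, _, X, _, Y, _, rfl⟩ := hz
    simp [width_cons]

theorem graft_of_width (x y : Forest W) (hx : x.width = 0) (hy : y.width = 0) :
    graft x y = {nil} := by
  rw [eq_nil_of_width _ hx, eq_nil_of_width _ hy]; rfl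
end Forest

noncomputable section
/-- The underlying module of the Grossman-Larson Hopf algebra: the free `K`-module on the trees
`B_+(F)`, with `F` running over the isomorphism classes of `W`-labelled rooted forests. -/
def HGL (K W : Type*) [CommRing K] : Type _ := Forest W →₀ K

namespace HGL
variable {K W : Type*} [CommRing K]

instance : AddCommGroup (HGL K W) := inferInstanceAs (AddCommGroup (Forest W →₀ K))
instance : Module K (HGL K W) := inferInstanceAs (Module K (Forest W →₀ K))

variable (K) in
/-- The basis vector of the tree `B_+(F)`. -/
def of (F : Forest W) : HGL K W := Finsupp.single F 1

variable (K) in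
/-- The linear map with given values on the basis. -/
def lift {M : Type*} [AddCommGroup M] [Module K M] (f : Forest W → M) : HGL K W →ₗ[K] M :=
  Finsupp.linearCombination K f

@[simp] theorem lift_of {M : Type*} [AddCommGroup M] [Module K M] (f : Forest W → M)
    (F : Forest W) : lift K f (of K F) = f F :=
  (Finsupp.linearCombination_single K 1 F).trans (one_smul _ _)

theorem hom_ext {M : Type*} [AddCommGroup M] [Module K M] {f g : HGL K W →ₗ[K] M}
    (h : ∀ F, f (of K F) = g (of K F)) : f = g :=
  Finsupp.lhom_ext' fun F => LinearMap.ext_ring (h F)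

theorem induct {p : HGL K W → Prop} (h : ∀ F, p (of K F)) (hadd : ∀ x y, p x → p y → p (x + y))
    (hsmul : ∀ (c : K) x, p x → p (c • x)) : ∀ x, p x := fun x => by
  refine Finsupp.induction_linear (motive := p) x ?_ hadd fun F c => ?_
  · have := hsmul 0 _ (h .nil)
    rwa [zero_smul] at this
  · have e : c • of K F = (Finsupp.single F c : Forest W →₀ K) :=
      (Finsupp.smul_single c F (1 : K)).trans (by simp)
    have := hsmul c _ (h F)
    rwa [e] at this

/-- The product `T ⬝ S`: the sum over all ways of connecting the branches at the root of `T` to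
vertices of `S`. -/
def mulHom : HGL K W →ₗ[K] HGL K W →ₗ[K] HGL K W :=
  lift K fun T => lift K fun S => ((Forest.graft T S).map (of K)).sum

instance : Mul (HGL K W) := ⟨fun x y => mulHom x y⟩
instance : One (HGL K W) := ⟨of K .nil⟩

theorem mul_def (x y : HGL K W) : x * y = mulHom x y := rfl
theorem one_def : (1 : HGL K W) = of K .nil := rfl

theorem of_mul_of (T S : Forest W) :
    of K T * of K S = ((Forest.graft T S).map (of K)).sum := by
  simp [mul_def, mulHom]

instance : NonUnitalNonAssocRing (HGL K W) where
  __ := (inferInstance : AddCommGroup (HGL K W))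
  mul := (· * ·)
  left_distrib a b c := by simp [mul_def]
  right_distrib a b c := by simp [mul_def]
  zero_mul a := by simp [mul_def]
  mul_zero a := by simp [mul_def]

theorem smul_mul' (c : K) (x y : HGL K W) : c • x * y = c • (x * y) := by simp [mul_def]
theorem mul_smul' (c : K) (x y : HGL K W) : x * c • y = c • (x * y) := by simp [mul_def]

theorem sum_mul (s : Multiset (HGL K W)) (y : HGL K W) :
    s.sum * y = (s.map fun x => x * y).sum := by
  simpa using (Multiset.sum_map_mul_right (s := s) (f := fun x => x) (a := y)).symm

theorem mul_sum (s : Multiset (HGL K W)) (y : HGL K W) :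
    y * s.sum = (s.map fun x => y * x).sum := by
  simpa using (Multiset.sum_map_mul_left (s := s) (f := fun x => x) (a := y)).symm

theorem sum_tmul {M N : Type*} [AddCommGroup M] [Module K M] [AddCommGroup N] [Module K N]
    (s : Multiset M) (y : N) : s.sum ⊗ₜ[K] y = (s.map fun x => x ⊗ₜ[K] y).sum :=
  map_multiset_sum ((TensorProduct.mk K M N).flip y) s

theorem tmul_sum {M N : Type*} [AddCommGroup M] [Module K M] [AddCommGroup N] [Module K N]
    (s : Multiset M) (y : N) : y ⊗ₜ[K] s.sum = (s.map fun x => y ⊗ₜ[K] x).sum :=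
  map_multiset_sum (TensorProduct.mk K N M y) s

theorem one_mul' (x : HGL K W) : 1 * x = x := by
  induction x using induct with
  | h F => rw [one_def, of_mul_of, Forest.nil_graft]; simp
  | hadd x y hx hy => rw [mul_add, hx, hy]
  | hsmul c x hx => rw [mul_smul', hx]

theorem mul_one' (x : HGL K W) : x * 1 = x := by
  induction x using induct with
  | h F => rw [one_def, of_mul_of, Forest.graft_nil]; simp
  | hadd x y hx hy => rw [add_mul, hx, hy]
  | hsmul c x hx => rw [smul_mul', hx]

theorem mul_assoc' (x y z : HGL K W) : x * y * z = x * (y * z) := by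
  induction x using induct with
  | hadd x y hx hy => simp only [add_mul, hx, hy]
  | hsmul c x hx => simp only [smul_mul', hx]
  | h X =>
  induction y using induct with
  | hadd x y hx hy => simp only [add_mul, mul_add, hx, hy]
  | hsmul c x hx => simp only [smul_mul', mul_smul', hx]
  | h Y =>
  induction z using induct with
  | hadd x y hx hy => simp only [mul_add, hx, hy]
  | hsmul c x hx => simp only [mul_smul', hx]
  | h Z =>
    have := congrArg (fun s => (s.map (of K)).sum) (Forest.graft_assoc X Y Z)
    simp only [Multiset.map_bind, Multiset.sum_bind] at this
    simpa only [of_mul_of, sum_mul, mul_sum, Multiset.map_map, Function.comp_def] using this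

instance : Ring (HGL K W) where
  __ := (inferInstance : NonUnitalNonAssocRing (HGL K W))
  one := 1
  mul_assoc := mul_assoc'
  one_mul := one_mul'
  mul_one := mul_one'

instance : Algebra K (HGL K W) := Algebra.ofModule smul_mul' mul_smul'

/-- The coproduct `Δ B_+(T_1, ..., T_m) = ∑ B_+(T_I) ⊗ B_+(T_J)` over `I ⊔ J = {1, ..., m}`; the
counit is 1 on the singleton and 0 on all other trees. -/
instance : CoalgebraStruct K (HGL K W) where
  comul := lift K fun T => ((Forest.split T).map fun p => of K p.1 ⊗ₜ[K] of K p.2).sum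
  counit := lift K fun T => if T.width = 0 then 1 else 0

theorem comul_of (T : Forest W) : Coalgebra.comul (R := K) (of K T) =
    ((Forest.split T).map fun p => of K p.1 ⊗ₜ[K] of K p.2).sum := lift_of _ _

theorem counit_of (T : Forest W) : Coalgebra.counit (R := K) (of K T) =
    if T.width = 0 then 1 else 0 := lift_of _ _

instance : Coalgebra K (HGL K W) where
  coassoc := hom_ext fun T => by
    have := Forest.sum_coassoc T fun x y z => of K x ⊗ₜ[K] (of K y ⊗ₜ[K] of K z)
    simpa [comul_of, map_multiset_sum, Multiset.map_map, Function.comp_def,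
      sum_tmul, tmul_sum] using this
  rTensor_counit_comp_comul := hom_ext fun T => by
    have := Forest.sum_counit T fun x => (1 : K) ⊗ₜ[K] of K x
    simpa [comul_of, counit_of, map_multiset_sum, Multiset.map_map, Function.comp_def,
      TensorProduct.ite_tmul] using this
  lTensor_counit_comp_comul := hom_ext fun T => by
    have := Forest.sum_counit T fun x => of K x ⊗ₜ[K] (1 : K)
    rw [Forest.sum_swap T fun x y => if x.width = 0 then of K y ⊗ₜ[K] (1 : K) else 0] at this
    simpa [comul_of, counit_of, map_multiset_sum, Multiset.map_map, Function.comp_def,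
      TensorProduct.tmul_ite] using this

theorem comul_mul' (x y : HGL K W) : Coalgebra.comul (R := K) (x * y) =
    Coalgebra.comul (R := K) x * Coalgebra.comul (R := K) y := by
  induction x using induct with
  | hadd x y hx hy => simp only [add_mul, map_add, hx, hy]
  | hsmul c x hx => simp only [map_smul, hx, smul_mul_assoc]
  | h X =>
  induction y using induct with
  | hadd x y hx hy => simp only [mul_add, map_add, hx, hy]
  | hsmul c x hx => simp only [map_smul, hx, mul_smul_comm]
  | h Y =>
    have := Forest.sum_split_graft X Y fun x y => of K x ⊗ₜ[K] of K y
    simp only [of_mul_of, map_multiset_sum, comul_of, Multiset.map_map, Function.comp_def, this]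
    rw [← Multiset.sum_map_mul_right]
    refine congrArg _ (Multiset.map_congr rfl fun p _ => ?_)
    rw [← Multiset.sum_map_mul_left]
    refine congrArg _ (Multiset.map_congr rfl fun q _ => ?_)
    simp only [Algebra.TensorProduct.tmul_mul_tmul, of_mul_of, sum_tmul, tmul_sum,
      Multiset.map_map, Function.comp_def]
    exact Multiset.sum_map_sum_map _ _

theorem counit_mul' (x y : HGL K W) : Coalgebra.counit (R := K) (x * y) =
    Coalgebra.counit (R := K) x * Coalgebra.counit (R := K) y := by
  induction x using induct with
  | hadd x y hx hy => simp only [add_mul, map_add, hx, hy]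
  | hsmul c x hx => simp only [map_smul, hx, smul_mul_assoc]
  | h X =>
  induction y using induct with
  | hadd x y hx hy => simp only [mul_add, map_add, hx, hy]
  | hsmul c x hx => simp only [map_smul, hx, mul_smul_comm]
  | h Y =>
    by_cases h : X.width = 0 ∧ Y.width = 0
    · rw [of_mul_of, Forest.graft_of_width X Y h.1 h.2]
      simp [counit_of, h.1, h.2, Forest.width_nil]
    · have : (X.graft Y).map (fun z => if z.width = 0 then (1 : K) else 0) =
          (X.graft Y).map fun _ => 0 :=
        Multiset.map_congr rfl fun z hz => by rw [if_neg]; rwa [Forest.width_graft X Y z hz]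
      simp only [of_mul_of, map_multiset_sum, Multiset.map_map, Function.comp_def, counit_of, this]
      rw [not_and_or] at h
      rcases h with h | h <;> simp [h]

instance : Bialgebra K (HGL K W) :=
  Bialgebra.mk' K (HGL K W) (by rw [one_def, counit_of, Forest.width_nil, if_pos rfl])
    (counit_mul' _ _)
    (by rw [one_def, comul_of, Forest.split_nil]; simp [Algebra.TensorProduct.one_def, one_def])
    (comul_mul' _ _)

open WithConv

variable (K W) in
/-- The map `η ε - id`, as an element of the convolution algebra. -/
def redId : WithConv (HGL K W →ₗ[K] HGL K W) := 1 - toConv LinearMap.id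

theorem redId_pow_of (k : ℕ) (T : Forest W) (h : T.width < k) : (redId K W ^ k) (of K T) = 0 := by
  induction k generalizing T with
  | zero => omega
  | succ k ih =>
    rw [pow_succ', LinearMap.convMul_apply, comul_of]
    simp only [map_multiset_sum, Multiset.map_map, Function.comp_def, TensorProduct.map_tmul,
      LinearMap.mul'_apply]
    refine Multiset.sum_eq_zero fun x hx => ?_
    obtain ⟨p, hp, rfl⟩ := Multiset.mem_map.1 hx
    have := Forest.width_split T p hp
    by_cases h0 : p.1.width = 0
    · rw [Forest.eq_nil_of_width _ h0]
      have : (redId K W).ofConv (of K Forest.nil) = 0 := by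
        rw [← one_def]; simp [redId]
      rw [this, zero_mul]
    · have := ih p.2 (by omega)
      have e : (redId K W ^ k).ofConv (of K p.2) = 0 := this
      rw [e, mul_zero]

/-- The antipode, `∑ k, (η ε - id)^{*k}` (a locally finite sum of convolution powers). -/
def antipodeHom : HGL K W →ₗ[K] HGL K W :=
  lift K fun T => ∑ k ∈ Finset.range (T.width + 1), ((redId K W) ^ k) (of K T)

theorem antipodeHom_of (T : Forest W) (N : ℕ) (h : T.width ≤ N) :
    antipodeHom (of K T) = (∑ k ∈ Finset.range (N + 1), (redId K W) ^ k).ofConv (of K T) := by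
  have e : ∀ s : Finset ℕ, (∑ k ∈ s, (redId K W) ^ k).ofConv (of K T) =
      ∑ k ∈ s, ((redId K W) ^ k) (of K T) := by
    intro s
    induction s using Finset.induction with
    | empty => rfl
    | insert a s ha ih => rw [Finset.sum_insert ha, Finset.sum_insert ha, ← ih]; rfl
  rw [e, antipodeHom, lift_of]
  refine Finset.sum_subset (by simpa using h) fun k _ hk => ?_
  exact redId_pow_of (K := K) k T (by simpa using hk)

theorem id_eq : toConv (LinearMap.id : HGL K W →ₗ[K] HGL K W) = 1 - redId K W := by
  simp [redId]

/-- The Grossman-Larson Hopf algebra. -/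
instance : HopfAlgebra K (HGL K W) where
  antipode := antipodeHom
  mul_antipode_rTensor_comul := hom_ext fun T => by
    have key : (∑ k ∈ Finset.range (T.width + 1), (redId K W) ^ k) * toConv LinearMap.id =
        1 - (redId K W) ^ (T.width + 1) := by
      rw [id_eq]; exact geom_sum_mul_neg _ _
    have key := congrArg (fun f => f.ofConv (of K T)) key
    have e : (1 - (redId K W) ^ (T.width + 1)).ofConv (of K T) =
      algebraMap K _ (Coalgebra.counit (of K T)) - ((redId K W) ^ (T.width + 1)) (of K T) := rfl
    rw [e, redId_pow_of (K := K) _ T (Nat.lt_succ_self _), sub_zero] at key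
    refine Eq.trans ?_ key
    change _ = LinearMap.mul' K _ (TensorProduct.map _ _ (Coalgebra.comul (of K T)))
    simp only [LinearMap.comp_apply, comul_of, map_multiset_sum, Multiset.map_map,
      Function.comp_def, LinearMap.rTensor_tmul, TensorProduct.map_tmul, LinearMap.mul'_apply]
    refine congrArg _ (Multiset.map_congr rfl fun p hp => ?_)
    rw [antipodeHom_of p.1 T.width (by have := Forest.width_split T p hp; omega)]
    rfl
  mul_antipode_lTensor_comul := hom_ext fun T => by
    have key : toConv LinearMap.id * (∑ k ∈ Finset.range (T.width + 1), (redId K W) ^ k) =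
        1 - (redId K W) ^ (T.width + 1) := by
      rw [id_eq]; exact mul_neg_geom_sum _ _
    have key := congrArg (fun f => f.ofConv (of K T)) key
    have e : (1 - (redId K W) ^ (T.width + 1)).ofConv (of K T) =
      algebraMap K _ (Coalgebra.counit (of K T)) - ((redId K W) ^ (T.width + 1)) (of K T) := rfl
    rw [e, redId_pow_of (K := K) _ T (Nat.lt_succ_self _), sub_zero] at key
    refine Eq.trans ?_ key
    change _ = LinearMap.mul' K _ (TensorProduct.map _ _ (Coalgebra.comul (of K T)))
    simp only [LinearMap.comp_apply, comul_of, map_multiset_sum, Multiset.map_map,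
      Function.comp_def, LinearMap.lTensor_tmul, TensorProduct.map_tmul, LinearMap.mul'_apply]
    refine congrArg _ (Multiset.map_congr rfl fun p hp => ?_)
    rw [antipodeHom_of p.2 T.width (by have := Forest.width_split T p hp; omega)]
    rfl
end HGL

/-! The Hopf algebra structure of universal enveloping algebras. -/

attribute [local instance] LieRing.ofAssociativeRing

namespace Envelop
attribute [-simp] UniversalEnvelopingAlgebra.ι_apply
variable (K : Type*) [CommRing K] (L : Type*) [LieRing L] [LieAlgebra K L]

local notation "𝒰" => UniversalEnvelopingAlgebra K L

theorem adjoin_ι : Algebra.adjoin K (Set.range (UniversalEnvelopingAlgebra.ι K : L → 𝒰)) = ⊤ := by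
  set A := Algebra.adjoin K (Set.range (UniversalEnvelopingAlgebra.ι K : L → 𝒰)) with hA
  let f : L →ₗ⁅K⁆ A :=
    { toFun := fun x => ⟨UniversalEnvelopingAlgebra.ι K x, Algebra.subset_adjoin ⟨x, rfl⟩⟩
      map_add' := fun x y => Subtype.ext (by simp)
      map_smul' := fun c x => Subtype.ext (by simp)
      map_lie' := fun {x y} => Subtype.ext (by
        simp only [LieHom.map_lie, LieRing.of_associative_ring_bracket]; rfl) }
  have h : A.val.comp (UniversalEnvelopingAlgebra.lift K f) = AlgHom.id K _ :=
    UniversalEnvelopingAlgebra.hom_ext K (LieHom.ext fun x => by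
      change ((UniversalEnvelopingAlgebra.lift K f (UniversalEnvelopingAlgebra.ι K x) : A) : 𝒰) = _
      rw [UniversalEnvelopingAlgebra.lift_ι_apply]; rfl)
  refine eq_top_iff.2 fun x _ => ?_
  have : x = A.val (UniversalEnvelopingAlgebra.lift K f x) :=
    (congrArg (fun g : 𝒰 →ₐ[K] 𝒰 => g x) h).symm
  rw [this]; exact Subtype.property _

variable {K L} in
theorem induct {p : 𝒰 → Prop} (h1 : p 1) (hadd : ∀ x y, p x → p y → p (x + y))
    (hsmul : ∀ (c : K) x, p x → p (c • x))
    (hι : ∀ l y, p y → p (UniversalEnvelopingAlgebra.ι K l * y)) (x : 𝒰) : p x := by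
  have hx : x ∈ Algebra.adjoin K (Set.range (UniversalEnvelopingAlgebra.ι K : L → 𝒰)) := by
    rw [adjoin_ι]; trivial
  suffices ∀ y, p y → p (x * y) by simpa using this 1 h1
  induction hx using Algebra.adjoin_induction with
  | mem x hx => obtain ⟨l, rfl⟩ := hx; exact hι l
  | algebraMap r => intro y hy; rw [← Algebra.smul_def]; exact hsmul r y hy
  | add x y _ _ hx hy => intro z hz; rw [add_mul]; exact hadd _ _ (hx z hz) (hy z hz)
  | mul x y _ _ hx hy => intro z hz; rw [mul_assoc]; exact hx _ (hy z hz)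

/-- The coproduct of the enveloping algebra: `Δ x = x ⊗ 1 + 1 ⊗ x` for `x ∈ L`. -/
def comulHom : 𝒰 →ₐ[K] 𝒰 ⊗[K] 𝒰 :=
  UniversalEnvelopingAlgebra.lift K
    { toFun := fun x => UniversalEnvelopingAlgebra.ι K x ⊗ₜ 1 + 1 ⊗ₜ UniversalEnvelopingAlgebra.ι K x
      map_add' := fun x y => by simp only [map_add, TensorProduct.add_tmul, TensorProduct.tmul_add]; abel
      map_smul' := fun c x => by simp [TensorProduct.smul_tmul']
      map_lie' := fun {x y} => by
        simp only [LieHom.map_lie, LieRing.of_associative_ring_bracket, mul_add, add_mul,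
          Algebra.TensorProduct.tmul_mul_tmul, one_mul, mul_one, TensorProduct.sub_tmul,
          TensorProduct.tmul_sub]
        abel }

/-- The counit of the enveloping algebra: `ε x = 0` for `x ∈ L`. -/
def counitHom : 𝒰 →ₐ[K] K := UniversalEnvelopingAlgebra.lift K 0

/-- The antipode of the enveloping algebra: the anti-homomorphism with `S x = -x` for `x ∈ L`. -/
def antipodeHom : 𝒰 →ₐ[K] 𝒰ᵐᵒᵖ :=
  UniversalEnvelopingAlgebra.lift K
    { toFun := fun x => MulOpposite.op (-UniversalEnvelopingAlgebra.ι K x)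
      map_add' := fun x y => by simp [add_comm]
      map_smul' := fun c x => by simp
      map_lie' := fun {x y} => by
        simp only [LieHom.map_lie, LieRing.of_associative_ring_bracket, ← MulOpposite.op_mul,
          ← MulOpposite.op_sub]
        congr 1
        noncomm_ring }

variable {K L}

@[simp] theorem comulHom_ι (x : L) : comulHom K L (UniversalEnvelopingAlgebra.ι K x) =
    UniversalEnvelopingAlgebra.ι K x ⊗ₜ 1 + 1 ⊗ₜ UniversalEnvelopingAlgebra.ι K x :=
  UniversalEnvelopingAlgebra.lift_ι_apply _ _ _

@[simp] theorem counitHom_ι (x : L) : counitHom K L (UniversalEnvelopingAlgebra.ι K x) = 0 :=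
  UniversalEnvelopingAlgebra.lift_ι_apply _ _ _

@[simp] theorem antipodeHom_ι (x : L) : antipodeHom K L (UniversalEnvelopingAlgebra.ι K x) =
    MulOpposite.op (-UniversalEnvelopingAlgebra.ι K x) :=
  UniversalEnvelopingAlgebra.lift_ι_apply _ _ _

theorem hom_ext' {A : Type*} [Ring A] [Algebra K A] {f g : 𝒰 →ₐ[K] A}
    (h : ∀ x, f (UniversalEnvelopingAlgebra.ι K x) = g (UniversalEnvelopingAlgebra.ι K x)) :
    f = g :=
  UniversalEnvelopingAlgebra.hom_ext K (LieHom.ext h)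

instance : Bialgebra K 𝒰 :=
  Bialgebra.ofAlgHom (comulHom K L) (counitHom K L)
    (hom_ext' fun x => by
      simp [TensorProduct.add_tmul, TensorProduct.tmul_add, Algebra.TensorProduct.one_def, add_assoc])
    (hom_ext' fun x => by simp)
    (hom_ext' fun x => by simp)

/-- The antipode as a linear map. -/
def antipodeLin : 𝒰 →ₗ[K] 𝒰 :=
  (MulOpposite.opLinearEquiv K).symm.toLinearMap ∘ₗ (antipodeHom K L).toLinearMap

theorem antipodeLin_one : antipodeLin (1 : 𝒰) = 1 := by simp [antipodeLin]

theorem antipodeLin_mul (x : L) (y : 𝒰) :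
    antipodeLin (UniversalEnvelopingAlgebra.ι K x * y) =
      - (antipodeLin y * UniversalEnvelopingAlgebra.ι K x) := by
  simp only [antipodeLin, LinearMap.comp_apply, AlgHom.toLinearMap_apply, map_mul, antipodeHom_ι]
  simp

theorem comul_eq (x : 𝒰) : Coalgebra.comul (R := K) x = comulHom K L x := rfl
theorem counit_eq (x : 𝒰) : Coalgebra.counit (R := K) x = counitHom K L x := rfl

theorem aux1 (l : L) (t : 𝒰 ⊗[K] 𝒰) : LinearMap.mul' K 𝒰 (antipodeLin.rTensor 𝒰
    ((UniversalEnvelopingAlgebra.ι K l ⊗ₜ 1 + 1 ⊗ₜ UniversalEnvelopingAlgebra.ι K l) * t)) = 0 := by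
  induction t with
  | zero => simp
  | add x y hx hy => rw [mul_add, map_add, map_add, hx, hy, add_zero]
  | tmul x y =>
    simp only [add_mul, Algebra.TensorProduct.tmul_mul_tmul, one_mul, map_add,
      LinearMap.rTensor_tmul, LinearMap.mul'_apply, antipodeLin_mul]
    noncomm_ring

theorem aux2 (l : L) (t : 𝒰 ⊗[K] 𝒰) : LinearMap.mul' K 𝒰 (antipodeLin.lTensor 𝒰
    ((UniversalEnvelopingAlgebra.ι K l ⊗ₜ 1 + 1 ⊗ₜ UniversalEnvelopingAlgebra.ι K l) * t)) =
    UniversalEnvelopingAlgebra.ι K l * LinearMap.mul' K 𝒰 (antipodeLin.lTensor 𝒰 t) -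
      LinearMap.mul' K 𝒰 (antipodeLin.lTensor 𝒰 t) * UniversalEnvelopingAlgebra.ι K l := by
  induction t with
  | zero => simp
  | add x y hx hy => rw [mul_add, map_add, map_add, hx, hy, map_add, map_add]; noncomm_ring
  | tmul x y =>
    simp only [add_mul, Algebra.TensorProduct.tmul_mul_tmul, one_mul, map_add,
      LinearMap.lTensor_tmul, LinearMap.mul'_apply, antipodeLin_mul]
    noncomm_ring

/-- The Hopf algebra structure of a universal enveloping algebra. -/
instance : HopfAlgebra K 𝒰 where
  antipode := antipodeLin
  mul_antipode_rTensor_comul := LinearMap.ext fun x => by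
    simp only [LinearMap.comp_apply, comul_eq, counit_eq]
    induction x using induct with
    | h1 => simp [Algebra.TensorProduct.one_def, antipodeLin_one]
    | hadd x y hx hy => simp only [map_add, hx, hy]
    | hsmul c x hx => simp only [map_smul, hx]
    | hι l y _ => rw [map_mul, comulHom_ι, aux1, map_mul, counitHom_ι, zero_mul, map_zero]
  mul_antipode_lTensor_comul := LinearMap.ext fun x => by
    simp only [LinearMap.comp_apply, comul_eq, counit_eq]
    induction x using induct with
    | h1 => simp [Algebra.TensorProduct.one_def, antipodeLin_one]
    | hadd x y hx hy => simp only [map_add, hx, hy]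
    | hsmul c x hx => simp only [map_smul, hx]
    | hι l y hy =>
      rw [map_mul, comulHom_ι, aux2, map_mul, counitHom_ι, zero_mul, map_zero, hy,
        Algebra.linearMap_apply, Algebra.commutes, sub_self]
end Envelop

/-! Formal power series and differential operators. -/

/-- A `K`-algebra `R` with a decreasing sequence of submodules `ord N`; used only for the rings of
formal power series below, with `ord N` the series of order at least `N`. -/
class OrderFiltration (K R : Type*) [CommRing K] [Ring R] [Algebra K R] where
  ord : ℕ → Submodule K R
  antitone_ord : Antitone ord

open OrderFiltration

/-- The Lie algebra, with the commutator bracket, of the `K`-derivations of `R` that increase the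
degree by at least `α - 1` (`α ≥ 1`). -/
def derA (K R : Type*) [CommRing K] [Ring R] [Algebra K R] [OrderFiltration K R] (α : ℕ) :
    LieSubalgebra K (Module.End K R) where
  carrier := {δ | (∀ u v : R, δ (u * v) = δ u * v + u * δ v) ∧
    ∀ (N : ℕ) (u : R), u ∈ ord (K := K) (R := R) N → δ u ∈ ord (K := K) (R := R) (N + (α - 1))}
  add_mem' := fun {a b} ha hb => ⟨fun u v => by
      simp only [LinearMap.add_apply, ha.1 u v, hb.1 u v, add_mul, mul_add]; abel,
    fun N u hu => Submodule.add_mem _ (ha.2 N u hu) (hb.2 N u hu)⟩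
  zero_mem' := ⟨fun u v => by simp, fun N u hu => Submodule.zero_mem _⟩
  smul_mem' := fun c a ha => ⟨fun u v => by
      simp only [LinearMap.smul_apply, ha.1 u v, smul_add, smul_mul_assoc, mul_smul_comm],
    fun N u hu => Submodule.smul_mem _ c (ha.2 N u hu)⟩
  lie_mem' := fun {a b} ha hb => ⟨fun u v => by
      simp only [LieRing.of_associative_ring_bracket, LinearMap.sub_apply, Module.End.mul_apply,
        ha.1, hb.1, map_add, sub_mul, mul_sub]
      abel,
    fun N u hu => by
      rw [LieRing.of_associative_ring_bracket]
      refine Submodule.sub_mem _ ?_ ?_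
      · exact antitone_ord (Nat.le_add_right _ _) (ha.2 _ _ (hb.2 N u hu))
      · exact antitone_ord (Nat.le_add_right _ _) (hb.2 _ _ (ha.2 N u hu))⟩

/-- The differential operator algebra: the unital subalgebra of `End_K(R)` generated by
the derivations that increase the degree by at least `α - 1`. -/
abbrev diffOp (K R : Type*) [CommRing K] [Ring R] [Algebra K R] [OrderFiltration K R] (α : ℕ) :
    Subalgebra K (Module.End K R) :=
  Algebra.adjoin K (derA K R α : Set (Module.End K R))

/-- The canonical map from the enveloping algebra of the Lie algebra of derivations to `End_K(R)`;
its image is the differential operator algebra. -/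
def envToEnd (K R : Type*) [CommRing K] [Ring R] [Algebra K R] [OrderFiltration K R] (α : ℕ) :
    UniversalEnvelopingAlgebra K (derA K R α) →ₐ[K] Module.End K R :=
  UniversalEnvelopingAlgebra.lift K (derA K R α).incl

/-- Formal power series with coefficients in `K` in noncommutative free variables indexed by `X`:
families of coefficients indexed by words. -/
def NCSeries (X K : Type*) : Type _ := List X → K

namespace NCSeries
variable {X Y K : Type*} [CommRing K]

instance : AddCommGroup (NCSeries X K) := inferInstanceAs (AddCommGroup (List X → K))
instance : Module K (NCSeries X K) := inferInstanceAs (Module K (List X → K))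

/-- The coefficient of a word. -/
def coeff (w : List X) (u : NCSeries X K) : K := u w

@[ext] theorem ext {u v : NCSeries X K} (h : ∀ w, coeff w u = coeff w v) : u = v := funext h

@[simp] theorem coeff_add (w : List X) (u v : NCSeries X K) :
    coeff w (u + v) = coeff w u + coeff w v := rfl
@[simp] theorem coeff_zero (w : List X) : coeff w (0 : NCSeries X K) = 0 := rfl
@[simp] theorem coeff_smul (w : List X) (c : K) (u : NCSeries X K) :
    coeff w (c • u) = c * coeff w u := rfl

/-- The coefficient of a word `w` in `u * v` is the sum of `u_p * v_s` over the factorizations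
`w = p s`. -/
instance : Mul (NCSeries X K) :=
  ⟨fun u v w => ∑ i ∈ Finset.range (w.length + 1), coeff (w.take i) u * coeff (w.drop i) v⟩

instance : One (NCSeries X K) := ⟨fun w => if w.length = 0 then 1 else 0⟩

theorem coeff_mul (w : List X) (u v : NCSeries X K) : coeff w (u * v) =
    ∑ i ∈ Finset.range (w.length + 1), coeff (w.take i) u * coeff (w.drop i) v := rfl

theorem coeff_one (w : List X) : coeff w (1 : NCSeries X K) = if w.length = 0 then 1 else 0 := rfl

instance : Ring (NCSeries X K) where
  __ := (inferInstance : AddCommGroup (NCSeries X K))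
  mul := (· * ·)
  one := 1
  left_distrib u v w := by ext; simp [coeff_mul, mul_add, Finset.sum_add_distrib]
  right_distrib u v w := by ext; simp [coeff_mul, add_mul, Finset.sum_add_distrib]
  zero_mul u := by ext; simp [coeff_mul]
  mul_zero u := by ext; simp [coeff_mul]
  one_mul u := by
    ext w
    rw [coeff_mul, Finset.sum_eq_single 0]
    · simp [coeff_one]
    · intro i hi h0
      have : (w.take i).length ≠ 0 := by
        rw [List.length_take]; have := Finset.mem_range.1 hi; omega
      rw [coeff_one, if_neg this, zero_mul]
    · simp
  mul_one u := by
    ext w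
    rw [coeff_mul, Finset.sum_eq_single w.length]
    · simp [coeff_one]
    · intro i hi h0
      have : (w.drop i).length ≠ 0 := by
        rw [List.length_drop]; have := Finset.mem_range.1 hi; omega
      rw [coeff_one, if_neg this, mul_zero]
    · simp
  mul_assoc u v s := by
    ext w
    simp only [coeff_mul, Finset.sum_mul, Finset.mul_sum, Finset.sum_sigma']
    refine Finset.sum_nbij' (fun p => ⟨p.2, p.1 - p.2⟩) (fun p => ⟨p.1 + p.2, p.1⟩) ?_ ?_ ?_ ?_ ?_
    · rintro ⟨i, j⟩ h
      simp only [Finset.mem_sigma, Finset.mem_range, List.length_take, List.length_drop] at h ⊢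
      omega
    · rintro ⟨i, j⟩ h
      simp only [Finset.mem_sigma, Finset.mem_range, List.length_take, List.length_drop] at h ⊢
      omega
    · rintro ⟨i, j⟩ h
      simp only [Finset.mem_sigma, Finset.mem_range, List.length_take] at h
      simp only [Sigma.mk.injEq, heq_eq_eq, and_true]
      omega
    · rintro ⟨i, j⟩ h
      simp
    · rintro ⟨i, j⟩ h
      simp only [Finset.mem_sigma, Finset.mem_range, List.length_take] at h
      have hj : j ≤ i := by omega
      simp only [List.take_take, min_eq_left hj, List.drop_drop, List.drop_take,
        Nat.add_sub_cancel' hj, mul_assoc]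

instance : Algebra K (NCSeries X K) :=
  Algebra.ofModule
    (fun c u v => by ext w; simp [coeff_mul, Finset.mul_sum, mul_assoc])
    (fun c u v => by ext w; simp [coeff_mul, Finset.mul_sum, mul_left_comm])

/-- `ord N` consists of the series without terms of degree less than `N`. -/
instance : OrderFiltration K (NCSeries X K) where
  ord N :=
    { carrier := {u | ∀ w : List X, w.length < N → coeff w u = 0}
      add_mem' := fun {a b} ha hb w hw => by rw [coeff_add, ha w hw, hb w hw, add_zero]
      zero_mem' := fun _ _ => rfl
      smul_mem' := fun c a ha w hw => by rw [coeff_smul, ha w hw, mul_zero] }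
  antitone_ord := fun _ _ h _ hu w hw => hu w (hw.trans_le h)

open Classical in
variable (K) in
/-- The free variable with index `x`. -/
def var (x : X) : NCSeries X K := fun w => if w = [x] then 1 else 0

/-- The derivation `[v ∂/∂z]`, which maps the variable `x` to `v x`: every occurrence of a variable
`x` in a word is replaced in turn by `v x`. Hence the coefficient of a word `w` is the
sum of `u_{p x s} * (v x)_d` over all factorizations `w = p d s` and all variables `x`. -/
def der [Fintype X] (v : X → NCSeries X K) : Module.End K (NCSeries X K) where
  toFun u := fun w => ∑ i ∈ Finset.range (w.length + 1), ∑ j ∈ Finset.range (w.length - i + 1),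
    ∑ x : X, coeff (w.take i ++ x :: w.drop (i + j)) u * coeff ((w.drop i).take j) (v x)
  map_add' u u' := by
    funext w
    simp only [coeff_add, add_mul, Finset.sum_add_distrib]
    rfl
  map_smul' c u := by
    funext w
    simp only [coeff_smul, mul_assoc, ← Finset.mul_sum]
    rfl

open Classical in
/-- Renaming (or identifying) variables along `f`: the coefficient of `w` is the sum of the
coefficients of all words that `f` maps letterwise to `w`. -/
def rename [Fintype X] (f : X → Y) : NCSeries X K →ₗ[K] NCSeries Y K where
  toFun u := fun w => ∑ g : Fin w.length → X,
    if (List.ofFn g).map f = w then coeff (List.ofFn g) u else 0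
  map_add' u u' := by
    funext w
    refine Eq.trans ?_ Finset.sum_add_distrib
    exact Finset.sum_congr rfl fun g _ => by split_ifs <;> simp
  map_smul' c u := by
    funext w
    refine Eq.trans ?_ (Finset.mul_sum _ _ _).symm
    exact Finset.sum_congr rfl fun g _ => by split_ifs <;> simp

/-- The operator `B_+([v_1 ∂/∂z], ..., [v_m ∂/∂z])`, that is,
`u(z) ↦ [v_1(w) ∂/∂z] ⋯ [v_m(w) ∂/∂z] u(z)` at `w = z`, for a second family `w` of free
variables: `Sum.inl i` stands for `z_i` and `Sum.inr i` for `w_i`. -/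
def bPlus {n : ℕ} (vs : List (Fin n → NCSeries (Fin n) K)) : Module.End K (NCSeries (Fin n) K) :=
  rename (Sum.elim id id) ∘ₗ
    (vs.map fun v => der (Sum.elim (fun i => rename Sum.inr (v i)) fun _ => 0)).prod ∘ₗ
      rename (Sum.inl : Fin n → Fin n ⊕ Fin n)

/-- The automorphisms `F_t(z) = z - H_t(z)` of the algebra of formal power series in `z` over
`K[[t]]` such that `H_t` has order at least `α` in `z` and vanishes at `t = 0`. -/
structure IsFormalAut {n : ℕ} (α : ℕ) (F : Fin n → NCSeries (Fin n) (PowerSeries K)) :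
    Prop where
  exists_aut : ∃ φ : NCSeries (Fin n) (PowerSeries K) ≃ₐ[PowerSeries K]
    NCSeries (Fin n) (PowerSeries K), ∀ i, φ (var (PowerSeries K) i) = F i
  order_ge : ∀ i, var (PowerSeries K) i - F i ∈ OrderFiltration.ord (K := PowerSeries K)
    (R := NCSeries (Fin n) (PowerSeries K)) α
  at_zero : ∀ i w, PowerSeries.constantCoeff (coeff w (var (PowerSeries K) i - F i)) = 0

/-- `z - F_t(z) = ∑_{m ∈ W} t^m H_{[m]}(z)`. -/
structure IsExpansion {n : ℕ} {W : Set ℕ+} (F : Fin n → NCSeries (Fin n) (PowerSeries K))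
    (H : W → Fin n → NCSeries (Fin n) K) : Prop where
  coeff_mem : ∀ (i : Fin n) (w : List (Fin n)) (m : W),
    PowerSeries.coeff (m : ℕ+) (coeff w (var (PowerSeries K) i - F i)) = coeff w (H m i)
  coeff_notMem : ∀ (i : Fin n) (w : List (Fin n)) (m : ℕ), (∀ k : W, ((k : ℕ+) : ℕ) ≠ m) →
    PowerSeries.coeff m (coeff w (var (PowerSeries K) i - F i)) = 0

end NCSeries

/-! The case of commutative variables. -/

namespace MvPowerSeries
variable {K : Type*} [CommRing K]

/-- `ord N` consists of the series without terms of total degree less than `N`. -/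
instance {X : Type*} : OrderFiltration K (MvPowerSeries X K) where
  ord N :=
    { carrier := {u | ∀ d : X →₀ ℕ, d.degree < N → coeff d u = 0}
      add_mem' := fun {a b} ha hb d hd => by rw [map_add, ha d hd, hb d hd, add_zero]
      zero_mem' := fun _ _ => map_zero _
      smul_mem' := fun c a ha d hd => by rw [map_smul, ha d hd, smul_zero] }
  antitone_ord := fun _ _ h _ hu w hw => hu w (hw.trans_le h)

/-- The derivation `[v ∂/∂z] = ∑ x, v_x ∂/∂x`, which maps the variable `x` to `v x`. -/
def vectorField {X : Type*} [Fintype X] (v : X → MvPowerSeries X K) :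
    Module.End K (MvPowerSeries X K) :=
  ∑ x, LinearMap.mulLeft K (v x) ∘ₗ (pderiv K x).toLinearMap

/-- The operator `B_+([v_1 ∂/∂z], ..., [v_m ∂/∂z])`, that is,
`u(z) ↦ [v_1(w) ∂/∂z] ⋯ [v_m(w) ∂/∂z] u(z)` at `w = z`, for a second family `w` of
variables: `Sum.inl i` stands for `z_i` and `Sum.inr i` for `w_i`. -/
def bPlus {n : ℕ} (vs : List (Fin n → MvPowerSeries (Fin n) K)) :
    Module.End K (MvPowerSeries (Fin n) K) :=
  (rename (Sum.elim id id)).toLinearMap ∘ₗ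
    (vs.map fun v => vectorField (Sum.elim (fun i => rename Sum.inr (v i)) fun _ => 0)).prod ∘ₗ
      (rename (Sum.inl : Fin n → Fin n ⊕ Fin n)).toLinearMap
/-- The automorphisms `F_t(z) = z - H_t(z)` of the algebra of formal power series in `z` over
`K[[t]]` such that `H_t` has order at least `α` in `z` and vanishes at `t = 0`. -/
structure IsFormalAut {n : ℕ} (α : ℕ) (F : Fin n → MvPowerSeries (Fin n) (PowerSeries K)) :
    Prop where
  exists_aut : ∃ φ : MvPowerSeries (Fin n) (PowerSeries K) ≃ₐ[PowerSeries K]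
    MvPowerSeries (Fin n) (PowerSeries K), ∀ i, φ (X i) = F i
  order_ge : ∀ i, X i - F i ∈ OrderFiltration.ord (K := PowerSeries K)
    (R := MvPowerSeries (Fin n) (PowerSeries K)) α
  at_zero : ∀ i d, PowerSeries.constantCoeff (coeff d (X i - F i)) = 0

/-- `z - F_t(z) = ∑_{m ∈ W} t^m H_{[m]}(z)`. -/
structure IsExpansion {n : ℕ} {W : Set ℕ+} (F : Fin n → MvPowerSeries (Fin n) (PowerSeries K))
    (H : W → Fin n → MvPowerSeries (Fin n) K) : Prop where
  coeff_mem : ∀ (i : Fin n) (d : Fin n →₀ ℕ) (m : W),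
    PowerSeries.coeff (m : ℕ+) (coeff d (X i - F i)) = coeff d (H m i)
  coeff_notMem : ∀ (i : Fin n) (d : Fin n →₀ ℕ) (m : ℕ), (∀ k : W, ((k : ℕ+) : ℕ) ≠ m) →
    PowerSeries.coeff m (coeff d (X i - F i)) = 0

end MvPowerSeries

section Trees
variable {K R ι L : Type*} [CommRing K] [Ring R] [Algebra K R]

/-- The vector fields `P_{T_1}, ..., P_{T_d}` of the trees `T_1, ..., T_d` of a forest, where
`P_T = B_+([P_{T_1} ∂/∂z], ..., [P_{T_d} ∂/∂z]) H_{[a]}` if the root of `T` has the label `a` and the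
branches `T_1, ..., T_d`. The parameter `B` is the operation `B_+`, with the empty `B_+`
being the identity, so that `P_T = H_{[a]}` for a singleton labelled `a`. -/
def treeFields (B : List (ι → R) → Module.End K R) (H : L → ι → R) :
    PlaneForest L → List (ι → R)
  | .nil => []
  | .cons a F G => (fun i => B (treeFields B H F) (H a i)) :: treeFields B H G

/-- The operator `D_T = B_+([P_{T_1} ∂/∂z], ..., [P_{T_m} ∂/∂z])` for `T = B_+(T_1, ..., T_m)`. -/
def treeOp (B : List (ι → R) → Module.End K R) (H : L → ι → R) (F : PlaneForest L) :
    Module.End K R :=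
  B (treeFields B H F)

end Trees

/-- The linear map `A` from a Hopf algebra to the differential operator algebra is a homomorphism of
Hopf algebras. The Hopf algebra structure of the differential operator algebra is the one
of the enveloping algebra `U` of the Lie algebra of derivations. Since `U` may be strictly
larger than the algebra of operators it acts by, the homomorphism has to be induced by a
homomorphism of Hopf algebras to `U`; in addition, it has to respect every coproduct and every
antipode that the algebra of operators itself has with
`Δ δ = 1 ⊗ δ + δ ⊗ 1` and `S δ = - δ` on derivations, and the counit `φ ↦ φ ⬝ 1`. -/
structure IsHopfHom {K R ℋ : Type*} [CommRing K] [Ring R] [Algebra K R] [OrderFiltration K R]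
    {α : ℕ} [Ring ℋ] [HopfAlgebra K ℋ] (A : ℋ →ₗ[K] diffOp K R α) : Prop where
  map_one : A 1 = 1
  map_mul : ∀ x y, A (x * y) = A x * A y
  exists_lift : ∃ A' : ℋ →ₐc[K] UniversalEnvelopingAlgebra K (derA K R α),
    (∀ x, envToEnd K R α (A' x) = A x) ∧
    ∀ x, A' (HopfAlgebra.antipode K x) = HopfAlgebra.antipode K (A' x)
  map_comul : ∀ Δ : diffOp K R α →ₐ[K] diffOp K R α ⊗[K] diffOp K R α,
    (∀ δ : diffOp K R α, (δ : Module.End K R) ∈ derA K R α → Δ δ = 1 ⊗ₜ δ + δ ⊗ₜ 1) →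
    ∀ x, Δ (A x) = TensorProduct.map A A (Coalgebra.comul x)
  map_counit : ∀ x, (A x : Module.End K R) 1 = algebraMap K R (Coalgebra.counit x)
  map_antipode : ∀ S : diffOp K R α →ₗ[K] diffOp K R α,
    S 1 = 1 → (∀ φ ψ, S (φ * ψ) = S ψ * S φ) →
    (∀ δ : diffOp K R α, (δ : Module.End K R) ∈ derA K R α → S δ = -δ) →
    ∀ x, A (HopfAlgebra.antipode K x) = S (A x)


end

/-! The Grossman-Larson algebra is the enveloping algebra of the pre-Lie algebra of labelled rooted
trees: it is generated by the trees whose root has one branch (`HGL.adjoin_tree`), these are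
primitive, and the only relations are their commutators, given by grafting one tree to the vertices
of the other minus the reverse. So elements of any algebra that satisfy these commutator relations
extend to an algebra homomorphism (`HGL.exists_algHom`). Applied to the classes of the derivations
`[P_T ∂/∂z]` in the enveloping algebra `U`, this produces the lift of the map. Compatibility with
coproduct, counit and antipode then only has to be checked on the primitive generators.

The universal property rests on triangularity. Multiplying a forest `G` on the left by a one-branch
tree puts the new tree next to `G`, up to terms with only as many trees as `G`
(`HGL.tree_mul_sub_mem_level`). Hence the value on a forest with `k + 1` trees is forced by the
values on at most `k` trees. That it does not depend on which tree is taken first is exactly the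
commutator relation, so no basis of `U` is needed.

The analytic input is a single identity: `[P_T ∂/∂z] D_G` is the sum of `D_X` over all ways of
grafting `T` to `B_+(G)` (`SeriesDouble.derOne_mul_forestOp`). It is the chain rule. Differentiating
an expression in `z` and `w` that is evaluated at `w = z` means differentiating in `z`, which adds
`T` as a branch at the root, and differentiating in `w`, which acts on the coefficients `P_S(w)` and
grafts `T` into the branches `S`. For one-branch `G` the identity gives the commutator relations,
because the two-branch terms are symmetric and cancel. By induction over products of generators it
also shows that the composite with the action on series is `T ↦ D_T` (`exists_isHopfHom`).

Identities between operators on series are checked on variables only: the operators are derivations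
or homomorphisms, they are continuous for the order filtration, and polynomials are dense.
`SeriesDouble` collects the properties used, and both kinds of variables supply an instance. -/

/-! ### Multiplication by one-branch trees, and generation of the Grossman-Larson algebra -/

namespace Forest
variable {W : Type*}

/-- A single tree cannot be divided: it is attached either inside the first tree, or to the common
root or one of the remaining trees. The common root is accounted for by the grafting onto `G`. -/
theorem graft_tree_cons (a b : W) (F F' G : Forest W) :
    graft (cons a F nil) (cons b F' G) = ((graft (cons a F nil) F').map fun X => cons b X G) +
      (graft (cons a F nil) G).map (cons b F') := by
  rw [graft_cons, split_cons, split_nil]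
  simp [nil_graft]

end Forest

noncomputable section

namespace HGL
variable {K W : Type*} [CommRing K]

variable (K) in
/-- Adding a tree, with root labelled `a` and branches `F`, at the root. -/
def consHom (a : W) (F : Forest W) : HGL K W →ₗ[K] HGL K W := lift K fun G => of K (.cons a F G)

variable (K) in
/-- The sum of the forests which arise by adding a tree with root labelled `b` whose branches are
obtained by grafting `T` to `F`. -/
def graftHom (T : Forest W) (b : W) (F : Forest W) : HGL K W →ₗ[K] HGL K W :=
  lift K fun G => ((Forest.graft T F).map fun X => of K (.cons b X G)).sum

variable (K) in
/-- The tree whose root has a single branch. -/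
def tree (a : W) (F : Forest W) : HGL K W := of K (.cons a F .nil)

theorem consHom_of (a : W) (F G : Forest W) : consHom K a F (of K G) = of K (.cons a F G) :=
  lift_of _ _

theorem graftHom_of (T : Forest W) (b : W) (F G : Forest W) : graftHom K T b F (of K G) =
    ((Forest.graft T F).map fun X => of K (.cons b X G)).sum :=
  lift_of _ _

theorem consHom_comm (a b : W) (F F' : Forest W) (y : HGL K W) :
    consHom K a F (consHom K b F' y) = consHom K b F' (consHom K a F y) := by
  induction y using induct with
  | h G => simp only [consHom_of, Forest.cons_swap a b]
  | hadd x y hx hy => simp only [map_add, hx, hy]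
  | hsmul c x hx => simp only [map_smul, hx]

theorem consHom_one (a : W) (F : Forest W) : consHom K a F 1 = tree K a F := consHom_of _ _ _

theorem graftHom_one (T : Forest W) (b : W) (F : Forest W) :
    graftHom K T b F 1 = ((Forest.graft T F).map (tree K b)).sum := graftHom_of _ _ _ _

/-- The linear form of `Forest.graft_tree_cons`; left multiplication by a generator is computed from
it by recursion on the number of trees. -/
theorem tree_mul_consHom (a b : W) (F F' : Forest W) (y : HGL K W) :
    tree K a F * consHom K b F' y =
      graftHom K (.cons a F .nil) b F' y + consHom K b F' (tree K a F * y) := by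
  induction y using induct with
  | h G =>
    rw [tree, consHom_of, of_mul_of, Forest.graft_tree_cons, graftHom_of, of_mul_of,
      Multiset.map_add, Multiset.sum_add, map_multiset_sum]
    simp only [Multiset.map_map, Function.comp_def, consHom_of]
  | hadd x y hx hy => simp only [map_add, mul_add, hx, hy]; abel
  | hsmul c x hx => simp only [map_smul, mul_smul_comm, hx, smul_add]

theorem tree_mul_tree (a b : W) (F F' : Forest W) : tree K a F * tree K b F' =
    graftHom K (.cons a F .nil) b F' 1 + consHom K b F' (tree K a F) := by
  rw [← consHom_one b, tree_mul_consHom, mul_one]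

variable (K W) in
/-- The span of the trees whose root has `k` branches. -/
def level (k : ℕ) : Submodule K (HGL K W) :=
  Submodule.span K {x | ∃ G : Forest W, G.width = k ∧ of K G = x}

theorem of_mem_level {G : Forest W} {k : ℕ} (h : G.width = k) : of K G ∈ level K W k :=
  Submodule.subset_span ⟨G, h, rfl⟩

theorem consHom_mem_level (a : W) (F : Forest W) {k : ℕ} {y : HGL K W} (hy : y ∈ level K W k) :
    consHom K a F y ∈ level K W (k + 1) := by
  induction hy using Submodule.span_induction with
  | mem x hx =>
    obtain ⟨G, rfl, rfl⟩ := hx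
    rw [consHom_of]
    exact of_mem_level (Forest.width_cons _ _ _)
  | zero => rw [map_zero]; exact Submodule.zero_mem _
  | add x y _ _ hx hy => rw [map_add]; exact Submodule.add_mem _ hx hy
  | smul c x _ hx => rw [map_smul]; exact Submodule.smul_mem _ _ hx

theorem graftHom_of_mem_level (T : Forest W) (b : W) (F G : Forest W) :
    graftHom K T b F (of K G) ∈ level K W (G.width + 1) := by
  rw [graftHom_of]
  refine multiset_sum_mem _ fun x hx => ?_
  obtain ⟨X, _, rfl⟩ := Multiset.mem_map.1 hx
  exact of_mem_level (Forest.width_cons _ _ _)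

/-- Triangularity of the product: a tree attached anywhere but at the root leaves the number of root
branches unchanged. The error therefore lies in the level of `G` itself, one below the leading term.
-/
theorem tree_mul_sub_mem_level (a : W) (F G : Forest W) :
    tree K a F * of K G - consHom K a F (of K G) ∈ level K W G.width := by
  induction G using Forest.ind with
  | h0 =>
    rw [← one_def, mul_one, consHom_one, sub_self]
    exact Submodule.zero_mem _
  | h1 b F' G _ ih =>
    rw [← consHom_of, tree_mul_consHom, consHom_comm, add_sub_assoc, ← map_sub,
      Forest.width_cons]
    exact Submodule.add_mem _ (graftHom_of_mem_level _ _ _ _) (consHom_mem_level _ _ ih)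

/-- The trees whose root has a single branch generate the Grossman-Larson algebra. -/
theorem adjoin_tree :
    Algebra.adjoin K (Set.range fun p : W × Forest W => tree K p.1 p.2) = ⊤ := by
  set A := Algebra.adjoin K (Set.range fun p : W × Forest W => tree K p.1 p.2)
  have key : ∀ k, level K W k ≤ Subalgebra.toSubmodule A := by
    intro k
    induction k with
    | zero =>
      refine Submodule.span_le.2 ?_
      rintro _ ⟨G, hG, rfl⟩
      rw [Forest.eq_nil_of_width G hG]
      exact A.one_mem
    | succ k ih =>
      refine Submodule.span_le.2 ?_
      rintro _ ⟨G, hG, rfl⟩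
      induction G using Forest.ind with
      | h0 => simp [Forest.width_nil] at hG
      | h1 a F G _ _ =>
        have hk : G.width = k := by simpa [Forest.width_cons] using hG
        -- Triangularity is solved for the leading term; the product and the error both involve
        -- level `k` only.
        have e : of K (.cons a F G) =
            tree K a F * of K G - (tree K a F * of K G - consHom K a F (of K G)) := by
          rw [consHom_of]; abel
        rw [e]
        exact A.sub_mem
          (A.mul_mem (Algebra.subset_adjoin ⟨(a, F), rfl⟩) (ih (of_mem_level hk)))
          (ih (hk ▸ tree_mul_sub_mem_level a F G))
  refine eq_top_iff.2 fun x _ => ?_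
  induction x using induct with
  | h G => exact key _ (of_mem_level rfl)
  | hadd x y hx hy => exact A.add_mem (hx trivial) (hy trivial)
  | hsmul c x hx => exact A.smul_mem (hx trivial) c

/-- Complements `algHom_ext` for statements that do not compare algebra homomorphisms, such as those
about antipodes. -/
theorem tree_induct {p : HGL K W → Prop} (h1 : p 1) (hadd : ∀ x y, p x → p y → p (x + y))
    (hsmul : ∀ (c : K) x, p x → p (c • x))
    (htree : ∀ a F y, p y → p (tree K a F * y)) (x : HGL K W) : p x := by
  have hx : x ∈ Algebra.adjoin K (Set.range fun p : W × Forest W => tree K p.1 p.2) := by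
    rw [adjoin_tree]; trivial
  suffices ∀ y, p y → p (x * y) by simpa using this 1 h1
  induction hx using Algebra.adjoin_induction with
  | mem x hx => obtain ⟨l, rfl⟩ := hx; exact htree l.1 l.2
  | algebraMap r => intro y hy; rw [← Algebra.smul_def]; exact hsmul r y hy
  | add x y _ _ hx hy => intro z hz; rw [add_mul]; exact hadd _ _ (hx z hz) (hy z hz)
  | mul x y _ _ hx hy => intro z hz; rw [mul_assoc]; exact hx _ (hy z hz)

theorem algHom_ext {A : Type*} [Semiring A] [Algebra K A] {f g : HGL K W →ₐ[K] A}
    (h : ∀ a F, f (tree K a F) = g (tree K a F)) : f = g := by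
  refine AlgHom.ext_of_adjoin_eq_top adjoin_tree ?_
  rintro _ ⟨p, rfl⟩
  exact h _ _

/-! ### The universal property of the Grossman-Larson algebra -/

section Extension
variable {U : Type*} [Ring U] [Algebra K U] {θ : W → Forest W → U}

/-- A linear map which is multiplicative for products of a tree with a single branch and a tree
with less than `k` branches. -/
structure IsPartialLift (θ : W → Forest W → U) (k : ℕ) (ψ : HGL K W →ₗ[K] U) : Prop where
  map_one : ψ 1 = 1
  map_tree_mul : ∀ a F G, Forest.width G < k → ψ (tree K a F * of K G) = θ a F * ψ (of K G)

namespace IsPartialLift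
variable {k : ℕ} {ψ : HGL K W →ₗ[K] U}

theorem map_tree_mul_level (h : IsPartialLift θ k ψ) (a : W) (F : Forest W) {j : ℕ} (hj : j < k)
    {y : HGL K W} (hy : y ∈ level K W j) : ψ (tree K a F * y) = θ a F * ψ y := by
  induction hy using Submodule.span_induction with
  | mem x hx => obtain ⟨G, rfl, rfl⟩ := hx; exact h.map_tree_mul a F G hj
  | zero => simp
  | add x y _ _ hx hy => simp only [mul_add, map_add, hx, hy]
  | smul c x _ hx => simp only [mul_smul_comm, map_smul, hx]

/-- Commutators of generators are differences of elements `graftHom K T b F 1`, which are sums of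
generators, so a partial lift is multiplicative for them as well. -/
theorem map_graftHom_one_mul (h : IsPartialLift θ k ψ) (T : Forest W) (b : W) (F : Forest W)
    {G : Forest W} (hG : G.width < k) : ψ (graftHom K T b F 1 * of K G) =
      ((Forest.graft T F).map (θ b)).sum * ψ (of K G) := by
  rw [graftHom_one, HGL.sum_mul, map_multiset_sum, ← Multiset.sum_map_mul_right, Multiset.map_map,
    Multiset.map_map]
  exact congrArg _ (Multiset.map_congr rfl fun X _ => h.map_tree_mul b X G hG)

/-- The value on a tree with `k + 1` branches forced by multiplicativity. -/
def nextValue (θ : W → Forest W → U) (ψ : HGL K W →ₗ[K] U) (a : W) (F G : Forest W) : U :=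
  θ a F * ψ (of K G) - ψ (tree K a F * of K G - consHom K a F (of K G))

/-- Write `t`, `t'` for the two one-branch trees and `r`, `r'` for the errors of `t * G` and `t' *
G`. Since two trees may be added in either order, the errors of the two products defining the values
differ by `[t, t'] * G - t * r' + t' * r`. As `r` and `r'` have level `G.width < k`, `ψ` is
multiplicative on all three terms, and the commutator relation `hθ` makes everything cancel. -/
theorem nextValue_swap
    (hθ : ∀ a F b F', θ a F * θ b F' - θ b F' * θ a F =
      ((Forest.graft (.cons a F .nil) F').map (θ b)).sum -
        ((Forest.graft (.cons b F' .nil) F).map (θ a)).sum)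
    (h : IsPartialLift θ k ψ) (a b : W) (F F' G : Forest W) (hG : G.width < k) :
    nextValue θ ψ a F (.cons b F' G) = nextValue θ ψ b F' (.cons a F G) := by
  have hu := tree_mul_sub_mem_level (K := K) a F G
  have hu' := tree_mul_sub_mem_level (K := K) b F' G
  have e1 : ψ (of K (.cons b F' G)) =
      θ b F' * ψ (of K G) - ψ (tree K b F' * of K G - consHom K b F' (of K G)) := by
    rw [← h.map_tree_mul b F' G hG, ← map_sub, sub_sub_cancel, consHom_of]
  have e2 : ψ (of K (.cons a F G)) =
      θ a F * ψ (of K G) - ψ (tree K a F * of K G - consHom K a F (of K G)) := by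
    rw [← h.map_tree_mul a F G hG, ← map_sub, sub_sub_cancel, consHom_of]
  have e3 := h.map_tree_mul_level a F hG hu'
  have e4 := h.map_tree_mul_level b F' hG hu
  have e5 : tree K a F * tree K b F' - tree K b F' * tree K a F =
      graftHom K (.cons a F .nil) b F' 1 - graftHom K (.cons b F' .nil) a F 1 := by
    rw [tree_mul_tree, tree_mul_tree, ← consHom_one a, ← consHom_one b, consHom_comm a b]
    abel
  have e6 : ψ ((tree K a F * tree K b F' - tree K b F' * tree K a F) * of K G) =
      (θ a F * θ b F' - θ b F' * θ a F) * ψ (of K G) := by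
    rw [e5, _root_.sub_mul, map_sub, h.map_graftHom_one_mul _ _ _ hG,
      h.map_graftHom_one_mul _ _ _ hG, hθ, _root_.sub_mul]
  have e7 : tree K a F * of K (.cons b F' G) - consHom K a F (of K (.cons b F' G)) -
      (tree K b F' * of K (.cons a F G) - consHom K b F' (of K (.cons a F G))) =
      (tree K a F * tree K b F' - tree K b F' * tree K a F) * of K G -
      tree K a F * (tree K b F' * of K G - consHom K b F' (of K G)) +
      tree K b F' * (tree K a F * of K G - consHom K a F (of K G)) := by
    rw [← consHom_of, ← consHom_of, consHom_comm a b]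
    simp only [_root_.mul_sub, _root_.sub_mul, mul_assoc]
    abel
  rw [← sub_eq_zero, nextValue, nextValue, sub_sub_sub_comm, ← map_sub, e7, map_add, map_sub, e3,
    e4, e6, e1, e2]
  noncomm_ring

theorem exists_next
    (hθ : ∀ a F b F', θ a F * θ b F' - θ b F' * θ a F =
      ((Forest.graft (.cons a F .nil) F').map (θ b)).sum -
        ((Forest.graft (.cons b F' .nil) F).map (θ a)).sum)
    (h : IsPartialLift θ k ψ) :
    ∃ ψ' : HGL K W →ₗ[K] U, IsPartialLift θ (k + 1) ψ' ∧
      ∀ G : Forest W, G.width ≤ k → ψ' (of K G) = ψ (of K G) := by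
  classical
  -- Only forests with exactly `k + 1` trees get a new value. It is defined through the first tree
  -- of a plane forest, so invariance under isomorphism has to be proved.
  let g : PlaneForest W → U := fun X => match X with
    | .nil => 1
    | .cons a F G => if G.width = k then nextValue θ ψ a (.mk F) (.mk G)
        else ψ (of K (.mk (.cons a F G)))
  have hg : ∀ F G : PlaneForest W, PlaneForest.Iso F G → g F = g G := by
    intro F G hFG
    induction hFG with
    | nil => rfl
    | @cons a F F' G G' h₁ h₂ _ _ =>
      have e₁ : Forest.mk F = Forest.mk F' := Quotient.sound h₁
      have e₂ : Forest.mk G = Forest.mk G' := Quotient.sound h₂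
      have e₃ : G.width = G'.width := congrArg Forest.width e₂
      have e₄ : Forest.mk (.cons a F G) = Forest.mk (.cons a F' G') :=
        Quotient.sound (.cons a h₁ h₂)
      simp only [g, e₁, e₂, e₃, e₄]
    | swap a b F F' G =>
      have e : Forest.mk (.cons a F (.cons b F' G)) = Forest.mk (.cons b F' (.cons a F G)) :=
        Quotient.sound (.swap a b F F' G)
      -- Both sides have `G.width + 2` trees; the new value is in force exactly when this number is
      -- `k + 1`.
      by_cases hk : G.width + 1 = k
      · simp only [g, PlaneForest.width, hk, if_true]
        exact nextValue_swap hθ h a b (.mk F) (.mk F') (.mk G) (by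
          have : Forest.width (.mk G) = G.width := rfl
          omega)
      · simp only [g, PlaneForest.width, hk, if_false, e]
    | trans _ _ h₁ h₂ => exact h₁.trans h₂
  let ψ' : HGL K W →ₗ[K] U := lift K (Quotient.lift g hg)
  have hcons : ∀ (a : W) (F G : Forest W), ψ' (of K (.cons a F G)) =
      if G.width = k then nextValue θ ψ a F G else ψ (of K (.cons a F G)) := by
    intro a F G
    induction F using Quotient.ind
    induction G using Quotient.ind
    exact lift_of _ _
  have h1 : ψ' 1 = 1 := lift_of _ _
  have hle : ∀ G : Forest W, G.width ≤ k → ψ' (of K G) = ψ (of K G) := by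
    intro G hG
    induction G using Forest.ind with
    | h0 => exact h1.trans h.map_one.symm
    | h1 a F G _ _ =>
      rw [Forest.width_cons] at hG
      rw [hcons, if_neg (by omega)]
  have hlevel : ∀ j ≤ k, ∀ x ∈ level K W j, ψ' x = ψ x := by
    intro j hj x hx
    refine LinearMap.eqOn_span (f := ψ') (g := ψ) ?_ hx
    rintro _ ⟨G, rfl, rfl⟩
    exact hle G hj
  refine ⟨ψ', ⟨h1, fun a F G hG => ?_⟩, hle⟩
  have e : tree K a F * of K G = (tree K a F * of K G - consHom K a F (of K G)) +
      of K (.cons a F G) := by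
    rw [consHom_of, sub_add_cancel]
  have hm := tree_mul_sub_mem_level (K := K) a F G
  rw [hle G (by omega)]
  by_cases hk : G.width = k
  · rw [e, map_add, hlevel _ hk.le _ hm, hcons, if_pos hk, nextValue]
    abel
  · rw [e, map_add, hlevel _ (by omega) _ hm, hcons, if_neg hk, ← map_add, ← e,
      h.map_tree_mul _ _ _ (by omega)]

end IsPartialLift

/-- The universal property of the Grossman-Larson algebra: it is the enveloping algebra
of the pre-Lie algebra of rooted trees. -/
theorem exists_algHom
    (hθ : ∀ a F b F', θ a F * θ b F' - θ b F' * θ a F =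
      ((Forest.graft (.cons a F .nil) F').map (θ b)).sum -
        ((Forest.graft (.cons b F' .nil) F).map (θ a)).sum) :
    ∃ φ : HGL K W →ₐ[K] U, ∀ a F, φ (tree K a F) = θ a F := by
  have h0 : IsPartialLift θ 0 (lift K fun G : Forest W => if G.width = 0 then (1 : U) else 0) :=
    ⟨by rw [one_def, lift_of, Forest.width_nil, if_pos rfl], fun a F G hG => by omega⟩
  let s : (k : ℕ) → {ψ : HGL K W →ₗ[K] U // IsPartialLift θ k ψ} := fun k =>
    Nat.rec ⟨_, h0⟩ (fun k ψ => ⟨(ψ.2.exists_next hθ).choose,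
      (ψ.2.exists_next hθ).choose_spec.1⟩) k
  have hs : ∀ k (G : Forest W), G.width ≤ k → (s (k + 1)).1 (of K G) = (s k).1 (of K G) :=
    fun k => ((s k).2.exists_next hθ).choose_spec.2
  have hs' : ∀ (G : Forest W) k, G.width ≤ k → (s k).1 (of K G) = (s G.width).1 (of K G) := by
    intro G k hk
    induction k, hk using Nat.le_induction with
    | base => rfl
    | succ k hk ih => rw [hs k G hk, ih]
  -- The stages are eventually constant on every forest, and `ψ` is their limit.
  let ψ : HGL K W →ₗ[K] U := lift K fun G => (s G.width).1 (of K G)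
  have hψ : ∀ (G : Forest W) k, G.width ≤ k → ψ (of K G) = (s k).1 (of K G) := fun G k hk =>
    (lift_of _ _).trans (hs' G k hk).symm
  have hlevel : ∀ j k, j ≤ k → ∀ x ∈ level K W j, ψ x = (s k).1 x := by
    intro j k hj x hx
    refine LinearMap.eqOn_span (f := ψ) (g := (s k).1) ?_ hx
    rintro _ ⟨G, rfl, rfl⟩
    exact hψ G k hj
  have h1 : ψ 1 = 1 := (hψ .nil 0 le_rfl).trans (s 0).2.map_one
  have hmul : ∀ a F y, ψ (tree K a F * y) = θ a F * ψ y := by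
    intro a F y
    induction y using induct with
    | h G =>
      have e : tree K a F * of K G = (tree K a F * of K G - consHom K a F (of K G)) +
          consHom K a F (of K G) := (sub_add_cancel _ _).symm
      -- Stage `G.width + 1` suffices for the product rule with `G` and already agrees with `ψ` on
      -- the product, which has at most `G.width + 1` root branches.
      rw [hψ G (G.width + 1) (Nat.le_succ _),
        ← (s (G.width + 1)).2.map_tree_mul a F G (Nat.lt_succ_self _), e, map_add,
        hlevel _ _ (Nat.le_succ G.width) _ (tree_mul_sub_mem_level a F G),
        hlevel _ _ le_rfl _ (consHom_mem_level a F (of_mem_level rfl)), map_add]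
    | hadd x y hx hy => simp only [mul_add, map_add, hx, hy]
    | hsmul c x hx => simp only [mul_smul_comm, map_smul, hx]
  refine ⟨AlgHom.ofLinearMap ψ h1 fun x y => ?_, fun a F => ?_⟩
  · induction x using tree_induct with
    | h1 => rw [one_mul, h1, one_mul]
    | hadd x x' hx hx' => simp only [add_mul, map_add, hx, hx']
    | hsmul c x hx => simp only [smul_mul_assoc, map_smul, hx]
    | htree a F x hx => rw [mul_assoc, hmul, hx, hmul, mul_assoc]
  · rw [AlgHom.ofLinearMap_apply, ← mul_one (tree K a F), hmul, h1, mul_one]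

theorem comul_tree (a : W) (F : Forest W) : Coalgebra.comul (R := K) (tree K a F) =
    tree K a F ⊗ₜ 1 + 1 ⊗ₜ tree K a F := by
  rw [tree, comul_of, Forest.split_cons, Forest.split_nil]
  simp [one_def]

theorem counit_tree (a : W) (F : Forest W) : Coalgebra.counit (R := K) (tree K a F) = 0 := by
  rw [tree, counit_of, Forest.width_cons, if_neg (Nat.succ_ne_zero _)]

end Extension
end HGL

-- From tree derivations to a homomorphism of Hopf algebras

attribute [local instance] LieRing.ofAssociativeRing

namespace HGL
variable {K W : Type*} [CommRing K]

/-- For a primitive element of counit 0 the antipode axiom reads `S x + x = 0`. -/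
theorem antipode_tree (a : W) (F : Forest W) :
    HopfAlgebra.antipode K (tree K a F) = -tree K a F := by
  have h := HopfAlgebra.mul_antipode_rTensor_comul_apply (R := K) (tree K a F)
  rw [comul_tree, counit_tree, map_zero] at h
  simpa [add_eq_zero_iff_eq_neg] using h

end HGL

namespace diffOp
variable {K R : Type*} [CommRing K] [Ring R] [Algebra K R] [OrderFiltration K R] {α : ℕ}

variable (K R α) in
/-- The canonical map from the enveloping algebra onto the differential operator algebra. -/
def ofEnv : UniversalEnvelopingAlgebra K (derA K R α) →ₐ[K] diffOp K R α :=
  UniversalEnvelopingAlgebra.lift K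
    { toFun := fun δ => ⟨δ, Algebra.subset_adjoin δ.2⟩
      map_add' := fun _ _ => rfl
      map_smul' := fun _ _ => rfl
      map_lie' := fun {_ _} => rfl }

theorem ofEnv_ι (δ : derA K R α) : (ofEnv K R α (UniversalEnvelopingAlgebra.ι K δ) :
    Module.End K R) = δ :=
  congrArg Subtype.val (UniversalEnvelopingAlgebra.lift_ι_apply K _ δ)

theorem coe_ofEnv (x : UniversalEnvelopingAlgebra K (derA K R α)) :
    (ofEnv K R α x : Module.End K R) = envToEnd K R α x := by
  have h : (diffOp K R α).val.comp (ofEnv K R α) = envToEnd K R α :=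
    Envelop.hom_ext' fun δ => (ofEnv_ι δ).trans
      (UniversalEnvelopingAlgebra.lift_ι_apply K (derA K R α).incl δ).symm
  exact congrArg (fun f : UniversalEnvelopingAlgebra K (derA K R α) →ₐ[K] Module.End K R => f x) h

theorem derA_one (δ : derA K R α) : (δ : Module.End K R) 1 = 0 := by
  have h := δ.2.1 1 1
  simpa using h

/-- Derivations kill scalars. By induction the remaining factors of a product send 1 to a scalar,
which a derivation applied last sends to 0. -/
theorem ofEnv_apply_one (x : UniversalEnvelopingAlgebra K (derA K R α)) :
    (ofEnv K R α x : Module.End K R) 1 = algebraMap K R (Coalgebra.counit x) := by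
  induction x using Envelop.induct with
  | h1 => simp
  | hadd x y hx hy =>
    rw [map_add, map_add, map_add, ← hx, ← hy]
    rfl
  | hsmul c x hx =>
    rw [map_smul, map_smul, smul_eq_mul, map_mul, ← hx, ← Algebra.smul_def]
    rfl
  | hι δ y hy =>
    rw [map_mul, Envelop.counit_eq, map_mul, Envelop.counitHom_ι, zero_mul, map_zero]
    change (ofEnv K R α (UniversalEnvelopingAlgebra.ι K δ) : Module.End K R)
      ((ofEnv K R α y : Module.End K R) 1) = 0
    rw [ofEnv_ι, hy, Algebra.algebraMap_eq_smul_one, map_smul, derA_one, smul_zero]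

end diffOp

/-- A map of the trees with a single branch to derivations which is compatible with grafting
induces a homomorphism of Hopf algebras. -/
theorem exists_isHopfHom {K R W : Type*} [CommRing K] [Ring R] [Algebra K R]
    [OrderFiltration K R] {α : ℕ} (D : Forest W → Module.End K R) (δ : W → Forest W → derA K R α)
    (hnil : D .nil = 1)
    (hD : ∀ a F G, (δ a F : Module.End K R) * D G =
      ((Forest.graft (.cons a F .nil) G).map D).sum) :
    ∃ A : HGL K W →ₗ[K] diffOp K R α,
      (∀ F, (A (HGL.of K F) : Module.End K R) = D F) ∧ IsHopfHom A := by
  have hδ : ∀ a F, (δ a F : Module.End K R) = D (.cons a F .nil) := by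
    intro a F
    have := hD a F .nil
    rwa [hnil, mul_one, Forest.graft_nil, Multiset.map_singleton, Multiset.sum_singleton] at this
  have hsum : ∀ b (s : Multiset (Forest W)),
      ((s.map (δ b)).sum : Module.End K R) = (s.map fun X => D (.cons b X .nil)).sum := by
    intro b s
    rw [← LieSubalgebra.coe_incl, map_multiset_sum, Multiset.map_map]
    exact congrArg _ (Multiset.map_congr rfl fun X _ => hδ b X)
  have hlie : ∀ a F b F', ⁅δ a F, δ b F'⁆ =
      ((Forest.graft (.cons a F .nil) F').map (δ b)).sum -
        ((Forest.graft (.cons b F' .nil) F).map (δ a)).sum := by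
    intro a F b F'
    -- The last term belongs to the tree with two branches, is symmetric in them, and drops out of
    -- the commutator.
    have e : ∀ a F b F', (δ a F : Module.End K R) * δ b F' =
        ((Forest.graft (.cons a F .nil) F').map fun X => D (.cons b X .nil)).sum +
          D (.cons b F' (.cons a F .nil)) := by
      intro a F b F'
      rw [hδ b F', hD, Forest.graft_tree_cons, Forest.graft_nil]
      simp
    apply Subtype.ext
    rw [LieSubalgebra.coe_bracket, LieRing.of_associative_ring_bracket, e, e,
      AddSubgroupClass.coe_sub, hsum, hsum, Forest.cons_swap a b]
    abel
  -- The target is the enveloping algebra and not the operator algebra: there the coproduct and the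
  -- antipode are available.
  obtain ⟨φ, hφ⟩ := HGL.exists_algHom (K := K)
    (θ := fun a F => UniversalEnvelopingAlgebra.ι K (δ a F)) (by
      intro a F b F'
      have h := congrArg (UniversalEnvelopingAlgebra.ι K) (hlie a F b F')
      rw [LieHom.map_lie, LieRing.of_associative_ring_bracket, map_sub, map_multiset_sum,
        map_multiset_sum, Multiset.map_map, Multiset.map_map] at h
      exact h)
  have hcounit : (Bialgebra.counitAlgHom K _).comp φ = Bialgebra.counitAlgHom K (HGL K W) :=
    HGL.algHom_ext fun a F => by
      rw [AlgHom.comp_apply, hφ, Bialgebra.counitAlgHom_apply, Bialgebra.counitAlgHom_apply,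
        HGL.counit_tree, Envelop.counit_eq, Envelop.counitHom_ι]
  have hcomul : (Algebra.TensorProduct.map φ φ).comp (Bialgebra.comulAlgHom K (HGL K W)) =
      (Bialgebra.comulAlgHom K _).comp φ :=
    HGL.algHom_ext fun a F => by
      rw [AlgHom.comp_apply, AlgHom.comp_apply, hφ, Bialgebra.comulAlgHom_apply,
        Bialgebra.comulAlgHom_apply, HGL.comul_tree, Envelop.comul_eq, Envelop.comulHom_ι, map_add,
        Algebra.TensorProduct.map_tmul, Algebra.TensorProduct.map_tmul, hφ, map_one]
  have hanti : ∀ x, φ (HopfAlgebra.antipode K x) = HopfAlgebra.antipode K (φ x) := by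
    intro x
    induction x using HGL.tree_induct with
    | h1 => rw [HopfAlgebra.antipode_one, map_one, HopfAlgebra.antipode_one]
    | hadd x y hx hy => rw [map_add, map_add, map_add, map_add, hx, hy]
    | hsmul c x hx => rw [map_smul, map_smul, map_smul, map_smul, hx]
    | htree a F y hy =>
      rw [HopfAlgebra.antipode_mul_antidistrib, map_mul, hy, HGL.antipode_tree, map_neg, hφ,
        map_mul, hφ]
      exact (mul_neg _ _).trans (Envelop.antipodeLin_mul _ _).symm
  let A : HGL K W →ₐ[K] diffOp K R α := (diffOp.ofEnv K R α).comp φ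
  have hA : ∀ a F, (A (HGL.tree K a F) : Module.End K R) = δ a F := fun a F => by
    change (diffOp.ofEnv K R α (φ _) : Module.End K R) = _
    rw [hφ, diffOp.ofEnv_ι]
  have hAder : ∀ a F, (A (HGL.tree K a F) : Module.End K R) ∈ derA K R α := fun a F => by
    rw [hA]; exact (δ a F).2
  -- `A` is known only on generators. This identity says that `D` intertwines left multiplication
  -- with `A`; evaluating it at `y = 1`, where `D` is the identity, identifies `A` with `D`.
  have hAD : ∀ x y, (A x : Module.End K R) * HGL.lift K D y = HGL.lift K D (x * y) := by
    intro x
    induction x using HGL.tree_induct with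
    | h1 => intro y; rw [map_one, one_mul]; exact one_mul _
    | hadd x x' hx hx' =>
      intro y
      rw [add_mul, map_add, map_add, ← hx, ← hx']
      exact add_mul _ _ _
    | hsmul c x hx =>
      intro y
      rw [smul_mul_assoc, map_smul, map_smul, ← hx]
      exact smul_mul_assoc _ _ _
    | htree a F x hx =>
      intro y
      rw [mul_assoc, map_mul]
      refine (mul_assoc (A (HGL.tree K a F) : Module.End K R) (A x) _).trans ?_
      rw [hx, hA]
      generalize x * y = z
      induction z using HGL.induct with
      | h G =>
        rw [HGL.lift_of, hD, HGL.tree, HGL.of_mul_of, map_multiset_sum, Multiset.map_map]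
        exact congrArg _ (Multiset.map_congr rfl fun X _ => (HGL.lift_of _ _).symm)
      | hadd z z' hz hz' => rw [map_add, mul_add, mul_add, map_add, hz, hz']
      | hsmul c z hz => rw [map_smul, mul_smul_comm, mul_smul_comm, map_smul, hz]
  refine ⟨A.toLinearMap, fun F => ?_, ?_⟩
  · have h := hAD (HGL.of K F) 1
    rw [mul_one, HGL.one_def, HGL.lift_of, HGL.lift_of, hnil, mul_one] at h
    exact h
  · refine ⟨map_one A, map_mul A, ⟨BialgHom.ofAlgHom φ hcounit hcomul,
      fun x => (diffOp.coe_ofEnv _).symm, hanti⟩, ?_, ?_, ?_⟩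
    · intro Δ hΔ x
      have h : Δ.comp A =
          (Algebra.TensorProduct.map A A).comp (Bialgebra.comulAlgHom K (HGL K W)) :=
        HGL.algHom_ext fun a F => by
          change Δ (A _) = Algebra.TensorProduct.map A A (Coalgebra.comul (HGL.tree K a F))
          rw [hΔ _ (hAder a F), HGL.comul_tree, map_add,
            Algebra.TensorProduct.map_tmul, Algebra.TensorProduct.map_tmul, map_one, add_comm]
      exact congrArg (fun f : HGL K W →ₐ[K] _ => f x) h
    · intro x
      refine (diffOp.ofEnv_apply_one (φ x)).trans (congrArg _ ?_)
      exact congrArg (fun f : HGL K W →ₐ[K] K => f x) hcounit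
    · intro S hS1 hSmul hSder x
      change A _ = S (A x)
      induction x using HGL.tree_induct with
      | h1 => rw [HopfAlgebra.antipode_one, map_one, hS1]
      | hadd x y hx hy => rw [map_add, map_add, map_add, map_add, hx, hy]
      | hsmul c x hx => rw [map_smul, map_smul, map_smul, map_smul, hx]
      | htree a F y hy =>
        rw [HopfAlgebra.antipode_mul_antidistrib, map_mul, hy, HGL.antipode_tree, map_neg,
          map_mul, hSmul, hSder _ (hAder a F)]

/-! ### Continuous derivations along homomorphisms -/

namespace OrderFiltration
variable {K A B C : Type*} [CommRing K] [Ring A] [Ring B] [Ring C] [Algebra K A] [Algebra K B]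
  [Algebra K C]

/-- `d` is a derivation along the homomorphism `f`. -/
def IsDerAlong (f : A →ₐ[K] B) (d : A →ₗ[K] B) : Prop := ∀ u v, d (u * v) = d u * f v + f u * d v

theorem IsDerAlong.map_one {f : A →ₐ[K] B} {d : A →ₗ[K] B} (h : IsDerAlong f d) : d 1 = 0 := by
  simpa using h 1 1

theorem IsDerAlong.add {f : A →ₐ[K] B} {d d' : A →ₗ[K] B} (h : IsDerAlong f d)
    (h' : IsDerAlong f d') : IsDerAlong f (d + d') := fun u v => by
  simp only [LinearMap.add_apply, h u v, h' u v, add_mul, mul_add]; abel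

theorem IsDerAlong.zero {f : A →ₐ[K] B} : IsDerAlong f (0 : A →ₗ[K] B) := fun u v => by simp

theorem IsDerAlong.comp_algHom {g : B →ₐ[K] C} {d : B →ₗ[K] C} (h : IsDerAlong g d)
    (f : A →ₐ[K] B) : IsDerAlong (g.comp f) (d ∘ₗ f.toLinearMap) := fun u v => by
  simp [h (f u) (f v)]

theorem IsDerAlong.algHom_comp {f : A →ₐ[K] B} {d : A →ₗ[K] B} (h : IsDerAlong f d)
    (g : B →ₐ[K] C) : IsDerAlong (g.comp f) (g.toLinearMap ∘ₗ d) := fun u v => by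
  simp [h u v]

theorem IsDerAlong.commutator {d d' : A →ₗ[K] A} (h : IsDerAlong (AlgHom.id K A) d)
    (h' : IsDerAlong (AlgHom.id K A) d') :
    IsDerAlong (AlgHom.id K A) (d ∘ₗ d' - d' ∘ₗ d) := fun u v => by
  have h : ∀ u v, d (u * v) = d u * v + u * d v := h
  have h' : ∀ u v, d' (u * v) = d' u * v + u * d' v := h'
  simp only [LinearMap.sub_apply, LinearMap.comp_apply, h, h', map_add, AlgHom.id_apply, sub_mul,
    mul_sub]
  abel

variable [OrderFiltration K A] [OrderFiltration K B] [OrderFiltration K C]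

/-- Continuity of a linear map for the topologies defined by the filtrations. -/
def IsCont (f : A →ₗ[K] B) : Prop :=
  ∀ N, ∃ M, ∀ u ∈ ord (K := K) (R := A) M, f u ∈ ord (K := K) (R := B) N

theorem IsCont.of_mem {f : A →ₗ[K] B}
    (h : ∀ N, ∀ u ∈ ord (K := K) (R := A) N, f u ∈ ord (K := K) (R := B) N) : IsCont f :=
  fun N => ⟨N, h N⟩

theorem IsCont.id : IsCont (LinearMap.id : A →ₗ[K] A) := .of_mem fun _ _ h => h

theorem IsCont.comp {g : B →ₗ[K] C} {f : A →ₗ[K] B} (hg : IsCont g) (hf : IsCont f) :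
    IsCont (g ∘ₗ f) := fun N => by
  obtain ⟨M, hM⟩ := hg N
  obtain ⟨L, hL⟩ := hf M
  exact ⟨L, fun u hu => hM _ (hL u hu)⟩

theorem IsCont.add {f g : A →ₗ[K] B} (hf : IsCont f) (hg : IsCont g) : IsCont (f + g) :=
  fun N => by
    obtain ⟨M, hM⟩ := hf N
    obtain ⟨L, hL⟩ := hg N
    exact ⟨max M L, fun u hu => Submodule.add_mem _
      (hM u (antitone_ord (le_max_left _ _) hu)) (hL u (antitone_ord (le_max_right _ _) hu))⟩

theorem IsCont.neg {f : A →ₗ[K] B} (hf : IsCont f) : IsCont (-f) := fun N => by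
  obtain ⟨M, hM⟩ := hf N
  exact ⟨M, fun u hu => Submodule.neg_mem _ (hM u hu)⟩

theorem IsCont.sub {f g : A →ₗ[K] B} (hf : IsCont f) (hg : IsCont g) : IsCont (f - g) := by
  rw [sub_eq_add_neg]; exact hf.add hg.neg

theorem IsCont.zero : IsCont (0 : A →ₗ[K] B) := .of_mem fun _ _ _ => Submodule.zero_mem _

variable (K B) in
/-- The filtration is separated. -/
def IsSeparated : Prop := ∀ b : B, (∀ N, b ∈ ord (K := K) (R := B) N) → b = 0

variable (K) in
/-- The polynomials in the elements `x i` are dense. -/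
def IsDense {ι : Type*} (x : ι → A) : Prop :=
  ∀ N (a : A), ∃ p ∈ Algebra.adjoin K (Set.range x), a - p ∈ ord (K := K) (R := A) N

theorem eq_of_eqOn_adjoin {ι : Type*} {x : ι → A} (hx : IsDense K x) (hB : IsSeparated K B)
    {d d' : A →ₗ[K] B} (hd : IsCont d) (hd' : IsCont d')
    (h : ∀ p ∈ Algebra.adjoin K (Set.range x), d p = d' p) : d = d' := by
  refine LinearMap.ext fun a => sub_eq_zero.1 (hB _ fun N => ?_)
  obtain ⟨M, hM⟩ := (hd.sub hd') N
  obtain ⟨p, hp, hap⟩ := hx M a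
  have e := hM _ hap
  rwa [LinearMap.sub_apply, map_sub, map_sub, h p hp, sub_sub_sub_cancel_right] at e

/-- Reduces operator identities to the variables. Derivations along `f` are needed because many of
the operators compared, such as a derivation composed with a substitution, go between two different
rings. -/
theorem IsDerAlong.ext {ι : Type*} {x : ι → A} (hx : IsDense K x) (hB : IsSeparated K B)
    {f : A →ₐ[K] B} {d d' : A →ₗ[K] B} (h : IsDerAlong f d) (h' : IsDerAlong f d')
    (hd : IsCont d) (hd' : IsCont d') (e : ∀ i, d (x i) = d' (x i)) : d = d' := by
  refine eq_of_eqOn_adjoin hx hB hd hd' fun p hp => ?_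
  induction hp using Algebra.adjoin_induction with
  | mem p hp => obtain ⟨i, rfl⟩ := hp; exact e i
  | algebraMap r =>
    rw [Algebra.algebraMap_eq_smul_one, map_smul, map_smul, h.map_one, h'.map_one]
  | add p q _ _ hp hq => rw [map_add, map_add, hp, hq]
  | mul p q _ _ hp hq => rw [h, h', hp, hq]

theorem algHom_ext {ι : Type*} {x : ι → A} (hx : IsDense K x) (hB : IsSeparated K B)
    {f g : A →ₐ[K] B} (hf : IsCont f.toLinearMap) (hg : IsCont g.toLinearMap)
    (e : ∀ i, f (x i) = g (x i)) : f = g := by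
  refine AlgHom.toLinearMap_injective (eq_of_eqOn_adjoin hx hB hf hg fun p hp => ?_)
  refine AlgHom.eqOn_adjoin_iff.2 ?_ hp
  rintro _ ⟨i, rfl⟩
  exact e i

end OrderFiltration

/-! ### The operation `B_+` in doubled variables -/

open OrderFiltration

/-- An algebra `R` of series in variables `z i`, and an algebra `S` of series in two families of
such variables, with its continuous derivations `der v` that map the variables to `v`. -/
structure SeriesDouble (K R S ι : Type*) [CommRing K] [Ring R] [Ring S] [Algebra K R] [Algebra K S]
    [OrderFiltration K R] [OrderFiltration K S] where
  z : ι → R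
  y : ι ⊕ ι → S
  left : R →ₐ[K] S
  right : R →ₐ[K] S
  fold : S →ₐ[K] R
  der : (ι ⊕ ι → S) → Module.End K S
  left_z : ∀ i, left (z i) = y (.inl i)
  right_z : ∀ i, right (z i) = y (.inr i)
  fold_inl : ∀ i, fold (y (.inl i)) = z i
  fold_inr : ∀ i, fold (y (.inr i)) = z i
  der_mul : ∀ v u u', der v (u * u') = der v u * u' + u * der v u'
  der_y : ∀ v x, der v (y x) = v x
  left_mem : ∀ N, ∀ u ∈ ord (K := K) N, left u ∈ ord (K := K) N
  right_mem : ∀ N, ∀ u ∈ ord (K := K) N, right u ∈ ord (K := K) N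
  fold_mem : ∀ N, ∀ u ∈ ord (K := K) N, fold u ∈ ord (K := K) N
  der_mem : ∀ α N v, (∀ x, v x ∈ ord (K := K) α) → ∀ u ∈ ord (K := K) N,
    der v u ∈ ord (K := K) (N + α - 1)
  mem_ord_zero : ∀ u : S, u ∈ ord (K := K) 0
  isDense_z : IsDense K z
  isDense_y : IsDense K y
  isSeparated_left : IsSeparated K R
  isSeparated_right : IsSeparated K S

namespace SeriesDouble
variable {K R S ι : Type*} [CommRing K] [Ring R] [Ring S] [Algebra K R] [Algebra K S]
  [OrderFiltration K R] [OrderFiltration K S] (𝒮 : SeriesDouble K R S ι)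

theorem isCont_left : IsCont 𝒮.left.toLinearMap := .of_mem 𝒮.left_mem
theorem isCont_right : IsCont 𝒮.right.toLinearMap := .of_mem 𝒮.right_mem
theorem isCont_fold : IsCont 𝒮.fold.toLinearMap := .of_mem 𝒮.fold_mem

theorem isCont_der (v : ι ⊕ ι → S) : IsCont (𝒮.der v) := fun N =>
  -- Without any condition on `v`, that is with order bound 0, a derivation lowers the order by at
  -- most one.
  ⟨N + 1, 𝒮.der_mem 0 (N + 1) v fun _ => 𝒮.mem_ord_zero _⟩

theorem isDerAlong_der (v : ι ⊕ ι → S) : IsDerAlong (AlgHom.id K S) (𝒮.der v) := 𝒮.der_mul v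

theorem fold_comp_left : 𝒮.fold.comp 𝒮.left = AlgHom.id K R :=
  algHom_ext 𝒮.isDense_z 𝒮.isSeparated_left (𝒮.isCont_fold.comp 𝒮.isCont_left) IsCont.id
    fun i => by simp [𝒮.left_z, 𝒮.fold_inl]

theorem fold_comp_right : 𝒮.fold.comp 𝒮.right = AlgHom.id K R :=
  algHom_ext 𝒮.isDense_z 𝒮.isSeparated_left (𝒮.isCont_fold.comp 𝒮.isCont_right) IsCont.id
    fun i => by simp [𝒮.right_z, 𝒮.fold_inr]

theorem fold_left (u : R) : 𝒮.fold (𝒮.left u) = u := DFunLike.congr_fun 𝒮.fold_comp_left u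
theorem fold_right (u : R) : 𝒮.fold (𝒮.right u) = u := DFunLike.congr_fun 𝒮.fold_comp_right u

theorem der_ext {d d' : Module.End K S} (h : IsDerAlong (AlgHom.id K S) d)
    (h' : IsDerAlong (AlgHom.id K S) d') (hd : IsCont d) (hd' : IsCont d')
    (el : ∀ i, d (𝒮.y (.inl i)) = d' (𝒮.y (.inl i)))
    (er : ∀ i, d (𝒮.y (.inr i)) = d' (𝒮.y (.inr i))) : d = d' :=
  IsDerAlong.ext 𝒮.isDense_y 𝒮.isSeparated_right h h' hd hd' (Sum.rec el er)

/-- The derivation `[v(w) ∂/∂z]`, for which the variables `w` are constants. -/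
def derLeft (v : ι → R) : Module.End K S := 𝒮.der (Sum.elim (fun i => 𝒮.right (v i)) fun _ => 0)

/-- The derivation `[v(w) ∂/∂w]`, for which the variables `z` are constants. -/
def derRight (v : ι → R) : Module.End K S := 𝒮.der (Sum.elim (fun _ => 0) fun i => 𝒮.right (v i))

/-- The operator `B_+` of a list of vector fields. -/
def bPlus (vs : List (ι → R)) : Module.End K R :=
  𝒮.fold.toLinearMap ∘ₗ (vs.map 𝒮.derLeft).prod ∘ₗ 𝒮.left.toLinearMap

/-- The derivation `[v ∂/∂z]`. -/
def derOne (v : ι → R) : Module.End K R :=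
  𝒮.fold.toLinearMap ∘ₗ 𝒮.derLeft v ∘ₗ 𝒮.left.toLinearMap

theorem derLeft_inl (v : ι → R) (i : ι) : 𝒮.derLeft v (𝒮.y (.inl i)) = 𝒮.right (v i) :=
  𝒮.der_y _ _
theorem derLeft_inr (v : ι → R) (i : ι) : 𝒮.derLeft v (𝒮.y (.inr i)) = 0 := 𝒮.der_y _ _
theorem derRight_inl (v : ι → R) (i : ι) : 𝒮.derRight v (𝒮.y (.inl i)) = 0 := 𝒮.der_y _ _
theorem derRight_inr (v : ι → R) (i : ι) : 𝒮.derRight v (𝒮.y (.inr i)) = 𝒮.right (v i) :=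
  𝒮.der_y _ _

theorem isCont_derLeft (v : ι → R) : IsCont (𝒮.derLeft v) := 𝒮.isCont_der _
theorem isCont_derRight (v : ι → R) : IsCont (𝒮.derRight v) := 𝒮.isCont_der _
theorem isDerAlong_derLeft (v : ι → R) : IsDerAlong (AlgHom.id K S) (𝒮.derLeft v) :=
  𝒮.isDerAlong_der _
theorem isDerAlong_derRight (v : ι → R) : IsDerAlong (AlgHom.id K S) (𝒮.derRight v) :=
  𝒮.isDerAlong_der _

theorem isCont_derOne (v : ι → R) : IsCont (𝒮.derOne v) :=
  𝒮.isCont_fold.comp ((𝒮.isCont_derLeft v).comp 𝒮.isCont_left)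

theorem derOne_mul (v : ι → R) (u u' : R) :
    𝒮.derOne v (u * u') = 𝒮.derOne v u * u' + u * 𝒮.derOne v u' := by
  have h : ∀ s t, 𝒮.derLeft v (s * t) = 𝒮.derLeft v s * t + s * 𝒮.derLeft v t := 𝒮.der_mul _
  simp [derOne, h, 𝒮.fold_left]

theorem isDerAlong_derOne (v : ι → R) : IsDerAlong (AlgHom.id K R) (𝒮.derOne v) := 𝒮.derOne_mul v

theorem derOne_z (v : ι → R) (i : ι) : 𝒮.derOne v (𝒮.z i) = v i := by
  simp [derOne, 𝒮.left_z, derLeft_inl, 𝒮.fold_right]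

theorem derLeft_right (v : ι → R) (u : R) : 𝒮.derLeft v (𝒮.right u) = 0 :=
  LinearMap.congr_fun (IsDerAlong.ext 𝒮.isDense_z 𝒮.isSeparated_right
    ((𝒮.isDerAlong_derLeft v).comp_algHom 𝒮.right) IsDerAlong.zero
    ((𝒮.isCont_derLeft v).comp 𝒮.isCont_right) IsCont.zero
    fun i => by simp [𝒮.right_z, derLeft_inr]) u

theorem derRight_comp_left (v : ι → R) : 𝒮.derRight v ∘ₗ 𝒮.left.toLinearMap = 0 :=
  IsDerAlong.ext 𝒮.isDense_z 𝒮.isSeparated_right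
    ((𝒮.isDerAlong_derRight v).comp_algHom 𝒮.left) IsDerAlong.zero
    ((𝒮.isCont_derRight v).comp 𝒮.isCont_left) IsCont.zero
    fun i => by simp [𝒮.left_z, derRight_inl]

theorem derRight_right (v : ι → R) (u : R) :
    𝒮.derRight v (𝒮.right u) = 𝒮.right (𝒮.derOne v u) :=
  LinearMap.congr_fun (IsDerAlong.ext 𝒮.isDense_z 𝒮.isSeparated_right
    ((𝒮.isDerAlong_derRight v).comp_algHom 𝒮.right)
    ((𝒮.isDerAlong_derOne v).algHom_comp 𝒮.right)
    ((𝒮.isCont_derRight v).comp 𝒮.isCont_right) (𝒮.isCont_right.comp (𝒮.isCont_derOne v))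
    fun i => by simp [𝒮.right_z, derRight_inr, derOne_z]) u

/-- The chain rule. -/
theorem derOne_comp_fold (v : ι → R) : 𝒮.derOne v ∘ₗ 𝒮.fold.toLinearMap =
    𝒮.fold.toLinearMap ∘ₗ (𝒮.derLeft v + 𝒮.derRight v) :=
  IsDerAlong.ext 𝒮.isDense_y 𝒮.isSeparated_left ((𝒮.isDerAlong_derOne v).comp_algHom 𝒮.fold)
    (((𝒮.isDerAlong_derLeft v).add (𝒮.isDerAlong_derRight v)).algHom_comp 𝒮.fold)
    ((𝒮.isCont_derOne v).comp 𝒮.isCont_fold)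
    (𝒮.isCont_fold.comp ((𝒮.isCont_derLeft v).add (𝒮.isCont_derRight v)))
    (Sum.rec (fun i => by simp [𝒮.fold_inl, derLeft_inl, derRight_inl, derOne_z, 𝒮.fold_right])
      fun i => by simp [𝒮.fold_inr, derLeft_inr, derRight_inr, derOne_z, 𝒮.fold_right])

/-- The values on the variables `z` are series in `w`, which every `derLeft` kills; both composites
vanish on all variables. This is why `B_+` is symmetric in its arguments. -/
theorem derLeft_comm (v w : ι → R) : 𝒮.derLeft v * 𝒮.derLeft w = 𝒮.derLeft w * 𝒮.derLeft v :=
  sub_eq_zero.1 (𝒮.der_ext ((𝒮.isDerAlong_derLeft v).commutator (𝒮.isDerAlong_derLeft w))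
    IsDerAlong.zero
    (((𝒮.isCont_derLeft v).comp (𝒮.isCont_derLeft w)).sub
      ((𝒮.isCont_derLeft w).comp (𝒮.isCont_derLeft v))) IsCont.zero
    (fun i => by simp [derLeft_inl, derLeft_right]) fun i => by simp [derLeft_inr])

/-- The derivation in the second variables differentiates the coefficients of `derLeft w`. In terms
of trees this is the grafting into a branch. -/
theorem derRight_commutator (v w : ι → R) :
    𝒮.derRight v * 𝒮.derLeft w - 𝒮.derLeft w * 𝒮.derRight v =
      𝒮.derLeft fun i => 𝒮.derOne v (w i) :=
  𝒮.der_ext ((𝒮.isDerAlong_derRight v).commutator (𝒮.isDerAlong_derLeft w))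
    (𝒮.isDerAlong_derLeft _)
    (((𝒮.isCont_derRight v).comp (𝒮.isCont_derLeft w)).sub
      ((𝒮.isCont_derLeft w).comp (𝒮.isCont_derRight v))) (𝒮.isCont_derLeft _)
    (fun i => by simp [derLeft_inl, derRight_inl, derRight_right])
    fun i => by simp [derLeft_inr, derRight_inr, derLeft_right]

/-- The derivation `[v(w) ∂/∂z]` depends additively on `v`. -/
def derLeftHom : (ι → R) →+ Module.End K S :=
  AddMonoidHom.mk' 𝒮.derLeft fun v w =>
    𝒮.der_ext (𝒮.isDerAlong_derLeft _) ((𝒮.isDerAlong_derLeft v).add (𝒮.isDerAlong_derLeft w))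
      (𝒮.isCont_derLeft _) ((𝒮.isCont_derLeft v).add (𝒮.isCont_derLeft w))
      (fun i => by simp [derLeft_inl]) fun i => by simp [derLeft_inr]

theorem derLeft_sum (s : Multiset (ι → R)) : 𝒮.derLeft s.sum = (s.map 𝒮.derLeft).sum :=
  map_multiset_sum 𝒮.derLeftHom s

/-! ### Tree operators and grafting -/

section Trees
variable {L : Type*} (H : L → ι → R)

/-- The composition of the derivations `[P_T(w) ∂/∂z]` for the trees `T` of a forest. -/
def forestDer : Forest L → Module.End K S :=
  Quotient.lift (fun F => ((treeFields 𝒮.bPlus H F).map 𝒮.derLeft).prod) <| by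
    intro F G h
    change PlaneForest.Iso F G at h
    induction h with
    | nil => rfl
    | cons a _ _ h₁ h₂ =>
      -- The vector field of a tree sees its branches only through the product of their derivations,
      -- so the equality of products `h₁` suffices.
      simp only [treeFields, List.map_cons, List.prod_cons, bPlus] at h₁ h₂ ⊢
      rw [h₁, h₂]
    | swap a b F F' G =>
      simp only [treeFields, List.map_cons, List.prod_cons, ← mul_assoc]
      rw [derLeft_comm]
    | trans _ _ h₁ h₂ => exact h₁.trans h₂

/-- The operator `D_T` of the tree `T` whose branches at the root form the given forest. -/
def forestOp (F : Forest L) : Module.End K R :=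
  𝒮.fold.toLinearMap ∘ₗ 𝒮.forestDer H F ∘ₗ 𝒮.left.toLinearMap

/-- The vector field `P_T` of the tree `T` with root labelled `a` and branches `F`. -/
def treeField (a : L) (F : Forest L) (i : ι) : R := 𝒮.forestOp H F (H a i)

theorem forestDer_nil : 𝒮.forestDer H .nil = 1 := rfl

theorem forestDer_cons (a : L) (F G : Forest L) :
    𝒮.forestDer H (.cons a F G) = 𝒮.derLeft (𝒮.treeField H a F) * 𝒮.forestDer H G := by
  induction F using Quotient.ind
  induction G using Quotient.ind
  rfl

theorem forestOp_nil : 𝒮.forestOp H .nil = 1 := LinearMap.ext 𝒮.fold_left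

/-- Transports an identity from the doubled variables to `z`: by the chain rule `[v ∂/∂z]` becomes
`derLeft v + derRight v` before `w = z` is set, and the term `forestDer * derRight v` disappears on
series in `z` alone. It is kept separate from `derRight_forestDer`, whose induction applies it to
the branches of a tree. -/
theorem derOne_mul_forestOp_of_forestDer (v : ι → R) (T G : Forest L)
    (h : 𝒮.derRight v * 𝒮.forestDer H G - 𝒮.forestDer H G * 𝒮.derRight v +
      𝒮.derLeft v * 𝒮.forestDer H G = ((Forest.graft T G).map (𝒮.forestDer H)).sum) :
    𝒮.derOne v * 𝒮.forestOp H G = ((Forest.graft T G).map (𝒮.forestOp H)).sum := by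
  have e : ((Forest.graft T G).map (𝒮.forestOp H)).sum = 𝒮.fold.toLinearMap ∘ₗ
      ((Forest.graft T G).map (𝒮.forestDer H)).sum ∘ₗ 𝒮.left.toLinearMap := by
    generalize Forest.graft T G = s
    induction s using Multiset.induction with
    | empty => simp
    | cons X s ih =>
      simp only [Multiset.map_cons, Multiset.sum_cons, ih, LinearMap.add_comp, LinearMap.comp_add]
      rfl
  rw [e, ← h]
  refine LinearMap.ext fun u => ?_
  have e1 := LinearMap.congr_fun (𝒮.derOne_comp_fold v) (𝒮.forestDer H G (𝒮.left u))
  have e2 : 𝒮.derRight v (𝒮.left u) = 0 := LinearMap.congr_fun (𝒮.derRight_comp_left v) u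
  refine e1.trans ?_
  simp only [LinearMap.comp_apply, LinearMap.add_apply, LinearMap.sub_apply, Module.End.mul_apply,
    AlgHom.toLinearMap_apply, e2, map_zero, sub_zero, add_comm]

/-- The commutator with `derRight` differentiates the coefficients and accounts for grafting at
vertices of the trees of `G`; the term with `derLeft` accounts for grafting at the root. -/
theorem derRight_forestDer (a : L) (F G : Forest L) :
    𝒮.derRight (𝒮.treeField H a F) * 𝒮.forestDer H G -
        𝒮.forestDer H G * 𝒮.derRight (𝒮.treeField H a F) +
      𝒮.derLeft (𝒮.treeField H a F) * 𝒮.forestDer H G =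
      ((Forest.graft (.cons a F .nil) G).map (𝒮.forestDer H)).sum := by
  induction G using Forest.ind with
  | h0 =>
    rw [Forest.graft_nil, forestDer_nil, mul_one, one_mul, sub_self, zero_add,
      Multiset.map_singleton, Multiset.sum_singleton, forestDer_cons, forestDer_nil]
  | h1 b F' G ih' ih =>
    -- The induction hypothesis for the branches `F'`, applied to `H b i`: differentiating the
    -- vector field of a tree grafts to all its vertices, the root labelled `b` included.
    have e1 : (fun i => 𝒮.derOne (𝒮.treeField H a F) (𝒮.treeField H b F' i)) =
        ((Forest.graft (.cons a F .nil) F').map (𝒮.treeField H b)).sum := by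
      funext i
      have h := LinearMap.congr_fun (𝒮.derOne_mul_forestOp_of_forestDer H _ _ F' ih') (H b i)
      refine h.trans ?_
      generalize Forest.graft (.cons a F .nil) F' = s
      induction s using Multiset.induction with
      | empty => simp
      | cons X s ih =>
        simp only [Multiset.map_cons, Multiset.sum_cons, LinearMap.add_apply, Pi.add_apply, ih]
        rfl
    have e2 := 𝒮.derRight_commutator (𝒮.treeField H a F) (𝒮.treeField H b F')
    rw [e1, derLeft_sum] at e2
    have e3 := 𝒮.derLeft_comm (𝒮.treeField H a F) (𝒮.treeField H b F')
    rw [Forest.graft_tree_cons, Multiset.map_add, Multiset.sum_add, Multiset.map_map,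
      Multiset.map_map]
    simp only [Function.comp_def, forestDer_cons]
    rw [Multiset.sum_map_mul_right, Multiset.sum_map_mul_left, ← ih]
    rw [Multiset.map_map] at e2
    simp only [Function.comp_def] at e2
    rw [← e2, ← mul_assoc (𝒮.derLeft (𝒮.treeField H a F)), e3]
    simp only [mul_add, mul_sub, sub_mul, mul_assoc]
    abel

theorem derOne_mul_forestOp (a : L) (F G : Forest L) :
    𝒮.derOne (𝒮.treeField H a F) * 𝒮.forestOp H G =
      ((Forest.graft (.cons a F .nil) G).map (𝒮.forestOp H)).sum :=
  𝒮.derOne_mul_forestOp_of_forestDer H _ _ G (𝒮.derRight_forestDer H a F G)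

variable {α : ℕ}

theorem derLeft_mem {v : ι → R} (hv : ∀ i, v i ∈ ord (K := K) α) (N : ℕ) {u : S}
    (hu : u ∈ ord (K := K) N) : 𝒮.derLeft v u ∈ ord (K := K) (N + α - 1) :=
  𝒮.der_mem α N _ (Sum.rec (fun i => 𝒮.right_mem α _ (hv i)) fun _ => Submodule.zero_mem _) u hu

theorem derOne_mem_derA (hα : 1 ≤ α) {v : ι → R} (hv : ∀ i, v i ∈ ord (K := K) α) :
    𝒮.derOne v ∈ derA K R α := by
  refine ⟨𝒮.derOne_mul v, fun N u hu => ?_⟩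
  -- The truncated differences `N + (α - 1)` and `N + α - 1` agree because `1 ≤ α`.
  rw [← Nat.add_sub_assoc hα]
  exact 𝒮.fold_mem _ _ (𝒮.derLeft_mem hv N (𝒮.left_mem N u hu))

/-- Vector fields of order at least `α ≥ 1` do not lower the order. Inductively the fields of all
branches have order at least `α`, since they arise by applying such operators to `H`. -/
theorem forestDer_mem (hα : 1 ≤ α) (hH : ∀ a i, H a i ∈ ord (K := K) α) (F : Forest L) (N : ℕ)
    {u : S} (hu : u ∈ ord (K := K) N) : 𝒮.forestDer H F u ∈ ord (K := K) N := by
  induction F using Forest.ind generalizing N u with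
  | h0 => exact hu
  | h1 a F G hF hG =>
    rw [forestDer_cons]
    refine antitone_ord (a := N) (b := N + α - 1) (by omega)
      (𝒮.derLeft_mem (fun i => ?_) N (hG N hu))
    exact 𝒮.fold_mem _ _ (hF α (𝒮.left_mem _ _ (hH a i)))

theorem treeField_mem (hα : 1 ≤ α) (hH : ∀ a i, H a i ∈ ord (K := K) α) (a : L) (F : Forest L)
    (i : ι) : 𝒮.treeField H a F i ∈ ord (K := K) α :=
  𝒮.fold_mem _ _ (𝒮.forestDer_mem H hα hH F α (𝒮.left_mem _ _ (hH a i)))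

theorem exists_isHopfHom (hα : 1 ≤ α) (hH : ∀ a i, H a i ∈ ord (K := K) α) :
    ∃ A : HGL K L →ₗ[K] diffOp K R α,
      (∀ T : PlaneForest L, (A (HGL.of K (Forest.mk T)) : Module.End K R) =
        treeOp 𝒮.bPlus H T) ∧ IsHopfHom A := by
  obtain ⟨A, hA, hA'⟩ := _root_.exists_isHopfHom (K := K) (𝒮.forestOp H)
    (fun a F => ⟨_, 𝒮.derOne_mem_derA hα (𝒮.treeField_mem H hα hH a F)⟩) (𝒮.forestOp_nil H)
    (𝒮.derOne_mul_forestOp H)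
  exact ⟨A, fun T => hA (.mk T), hA'⟩

end Trees
end SeriesDouble

/-! ### Noncommutative series -/

namespace NCSeries
variable {X Y K : Type*} [CommRing K]

/-- The series of those terms of `u` that start with `a`, with this first letter removed. -/
def tail (a : X) : NCSeries X K →ₗ[K] NCSeries X K where
  toFun u := fun w => coeff (a :: w) u
  map_add' _ _ := rfl
  map_smul' _ _ := rfl

theorem coeff_tail (a : X) (w : List X) (u : NCSeries X K) :
    coeff w (tail a u) = coeff (a :: w) u := rfl

/-- A word is empty or has a first letter. Stripping this letter turns the factorization sums in
products, derivations and renamings into recursions along words. -/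
theorem ext_tail {u v : NCSeries X K} (h0 : coeff [] u = coeff [] v)
    (h : ∀ a, tail a u = tail a v) : u = v := by
  ext w
  cases w with
  | nil => exact h0
  | cons a w => exact congrArg (coeff w) (h a)

theorem coeff_nil_mul (u v : NCSeries X K) : coeff [] (u * v) = coeff [] u * coeff [] v := by
  simp [coeff_mul]

theorem coeff_sum {ι : Type*} (s : Finset ι) (f : ι → NCSeries X K) (w : List X) :
    coeff w (∑ i ∈ s, f i) = ∑ i ∈ s, coeff w (f i) :=
  map_sum (⟨⟨coeff w, coeff_zero w⟩, coeff_add w⟩ : NCSeries X K →+ K) f s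

/-- In a factorization of a word starting with `a`, the first letter belongs to the left factor
unless that factor is empty. -/
theorem tail_mul (a : X) (u v : NCSeries X K) :
    tail a (u * v) = tail a u * v + coeff [] u • tail a v := by
  ext w
  rw [coeff_tail, coeff_mul, List.length_cons, Finset.sum_range_succ', coeff_add, coeff_smul,
    coeff_mul]
  rfl

theorem coeff_nil_one : coeff [] (1 : NCSeries X K) = 1 := rfl

theorem tail_one (a : X) : tail a (1 : NCSeries X K) = 0 := rfl

theorem coeff_nil_var (x : X) : coeff [] (var K x) = 0 := by
  classical
  exact (if_neg (List.cons_ne_nil x []).symm : (if [] = [x] then (1 : K) else 0) = 0)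

theorem tail_var [DecidableEq X] (a x : X) : tail a (var K x) = if a = x then 1 else 0 := by
  ext w
  have h : coeff (a :: w) (var K x) = if a :: w = [x] then 1 else 0 := by
    unfold coeff var; congr
  rw [coeff_tail, h]
  by_cases hax : a = x <;> simp [hax, coeff_one]

theorem mem_ord {N : ℕ} {u : NCSeries X K} :
    u ∈ ord (K := K) N ↔ ∀ w : List X, w.length < N → coeff w u = 0 := Iff.rfl

theorem mem_ord_zero (u : NCSeries X K) : u ∈ ord (K := K) 0 :=
  mem_ord.2 fun _ h => absurd h (by simp)

variable (X K) in
theorem isSeparated : IsSeparated K (NCSeries X K) := fun _ hu =>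
  ext fun w => hu (w.length + 1) w (Nat.lt_succ_self _)

theorem var_mul_mem_ord (x : X) {N : ℕ} {u : NCSeries X K} (hu : u ∈ ord (K := K) N) :
    var K x * u ∈ ord (K := K) (N + 1) := by
  classical
  intro w hw
  cases w with
  | nil => rw [coeff_nil_mul, coeff_nil_var, zero_mul]
  | cons a w =>
    rw [← coeff_tail, tail_mul, tail_var, coeff_nil_var, zero_smul, add_zero]
    split_ifs
    · rw [one_mul]; exact hu w (by simpa using hw)
    · rw [zero_mul]; rfl

theorem eq_sum_var_mul_tail [Fintype X] (u : NCSeries X K) :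
    u = coeff [] u • 1 + ∑ x, var K x * tail x u := by
  classical
  refine ext_tail ?_ fun a => ?_
  · simp [coeff_sum, coeff_nil_mul, coeff_nil_var, coeff_nil_one]
  · simp [map_sum, tail_mul, tail_var, coeff_nil_var, tail_one]

-- Approximating each tail in `u = u_0 + ∑ x, x * tail x u` up to order `N` approximates `u` up to
-- order `N + 1`, since multiplication by a variable raises the order.
variable (X K) in
theorem isDense_var [Fintype X] : IsDense K (var K : X → NCSeries X K) := by
  intro N
  induction N with
  | zero => exact fun u => ⟨0, Subalgebra.zero_mem _, mem_ord_zero _⟩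
  | succ N ih =>
    intro u
    choose p hp hup using fun x => ih (tail x u)
    refine ⟨coeff [] u • 1 + ∑ x, var K x * p x, ?_, ?_⟩
    · exact Subalgebra.add_mem _ (Subalgebra.smul_mem _ (Subalgebra.one_mem _) _)
        (Subalgebra.sum_mem _ fun x _ => Subalgebra.mul_mem _
          (Algebra.subset_adjoin ⟨x, rfl⟩) (hp x))
    · conv => enter [2, 1]; rw [eq_sum_var_mul_tail u]
      rw [add_sub_add_left_eq_sub, ← Finset.sum_sub_distrib]
      refine Submodule.sum_mem _ fun x _ => ?_
      rw [← mul_sub]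
      exact var_mul_mem_ord x (hup x)

section Der
variable [Fintype X] (v : X → NCSeries X K)

/-- The terms of the derivation in which the first letter of a word is replaced. -/
def derHead (u : NCSeries X K) : NCSeries X K := ∑ x, v x * tail x u

theorem coeff_der (u : NCSeries X K) (w : List X) : coeff w (der v u) =
    ∑ i ∈ Finset.range (w.length + 1), ∑ j ∈ Finset.range (w.length - i + 1),
      ∑ x : X, coeff (w.take i ++ x :: w.drop (i + j)) u * coeff ((w.drop i).take j) (v x) := rfl

theorem coeff_derHead (u : NCSeries X K) (w : List X) : coeff w (derHead v u) =
    ∑ j ∈ Finset.range (w.length + 1), ∑ x : X, coeff (x :: w.drop j) u * coeff (w.take j) (v x) := by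
  rw [derHead, coeff_sum, Finset.sum_comm]
  refine Finset.sum_congr rfl fun x _ => ?_
  rw [coeff_mul]
  exact Finset.sum_congr rfl fun j _ => mul_comm _ _

theorem coeff_nil_der (u : NCSeries X K) : coeff [] (der v u) = coeff [] (derHead v u) := by
  simp [coeff_der, coeff_derHead]

/-- The factorizations `p d s` with `p` empty give the first summand; otherwise `a` is the first
letter of `p` and can be stripped from `u` beforehand. -/
theorem tail_der (a : X) (u : NCSeries X K) :
    tail a (der v u) = tail a (derHead v u) + der v (tail a u) := by
  ext w
  rw [coeff_tail, coeff_der, List.length_cons, Finset.sum_range_succ', add_comm, coeff_add,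
    coeff_tail, coeff_derHead, coeff_der]
  congr 1
  · simp
  · refine Finset.sum_congr rfl fun i _ => ?_
    rw [Nat.add_sub_add_right]
    refine Finset.sum_congr rfl fun j _ => Finset.sum_congr rfl fun x _ => ?_
    rw [Nat.add_right_comm]
    rfl

theorem derHead_mul (u u' : NCSeries X K) :
    derHead v (u * u') = derHead v u * u' + coeff [] u • derHead v u' := by
  simp [derHead, tail_mul, mul_add, Finset.sum_add_distrib, Finset.sum_mul, Finset.smul_sum,
    mul_assoc]

/-- Induction along the word for all pairs of series at once: the recursions for `tail`, `der` and
`derHead` reduce a word `a w` to the Leibniz rule at `w` for the pair `tail a u`, `u'` and to terms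
linear in `tail a u'`. -/
theorem der_mul (u u' : NCSeries X K) : der v (u * u') = der v u * u' + u * der v u' := by
  ext w
  induction w generalizing u u' with
  | nil =>
    simp only [coeff_add, coeff_nil_mul, coeff_nil_der, derHead_mul, coeff_smul]
  | cons a w ih =>
    rw [← coeff_tail, ← coeff_tail]
    have e : tail a (der v u * u' + u * der v u') =
        tail a (derHead v u * u') + coeff [] u • tail a (derHead v u') +
          (der v (tail a u) * u' + tail a u * der v u') + coeff [] u • der v (tail a u') := by
      simp only [map_add, tail_mul, tail_der, coeff_nil_der, add_mul, smul_add]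
      abel
    rw [e, tail_der, derHead_mul, tail_mul, map_add, map_add, map_smul, map_smul]
    simp only [coeff_add, ih]
    ring

theorem der_one : der v (1 : NCSeries X K) = 0 := by
  simpa using der_mul v 1 1

theorem der_var (x : X) : der v (var K x) = v x := by
  classical
  have h : derHead v (var K x) = v x := by
    simp [derHead, tail_var]
  refine ext_tail (by rw [coeff_nil_der, h]) fun a => ?_
  rw [tail_der, h, tail_var]
  split_ifs
  · rw [der_one, add_zero]
  · rw [map_zero, add_zero]

theorem der_mem_ord {α N : ℕ} {v : X → NCSeries X K} (hv : ∀ x, v x ∈ ord (K := K) α)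
    {u : NCSeries X K} (hu : u ∈ ord (K := K) N) : der v u ∈ ord (K := K) (N + α - 1) := by
  intro w hw
  rw [coeff_der]
  refine Finset.sum_eq_zero fun i hi => Finset.sum_eq_zero fun j hj =>
    Finset.sum_eq_zero fun x _ => ?_
  rw [Finset.mem_range] at hi hj
  -- Either the inserted piece is shorter than `α`, or the word in which it is replaced by one
  -- letter has length `w.length - j + 1 < N`.
  by_cases hjα : j < α
  · rw [hv x _ (by rw [List.length_take]; omega), mul_zero]
  · rw [hu _ (by simp only [List.length_append, List.length_take, List.length_cons,
      List.length_drop]; omega), zero_mul]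

end Der

section Rename
variable [Fintype X] (f : X → Y)

theorem coeff_rename [DecidableEq Y] (u : NCSeries X K) (w : List Y) : coeff w (rename f u) =
    ∑ g : Fin w.length → X, if (List.ofFn g).map f = w then coeff (List.ofFn g) u else 0 := by
  change (∑ g : Fin w.length → X, _) = _
  refine Finset.sum_congr rfl fun g _ => ?_
  congr

theorem coeff_nil_rename (u : NCSeries X K) : coeff [] (rename f u) = coeff [] u := by
  classical
  rw [coeff_rename]
  simp

theorem tail_rename [DecidableEq Y] (b : Y) (u : NCSeries X K) :
    tail b (rename f u) = ∑ a : X, if f a = b then rename f (tail a u) else 0 := by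
  ext w
  rw [coeff_tail, coeff_rename, coeff_sum]
  -- A preimage of the word `b w` is split into its first letter `a`, which must lie over `b`, and a
  -- preimage of `w`.
  refine ((Fin.consEquiv fun _ : Fin (w.length + 1) => X).sum_comp _).symm.trans ?_
  rw [Fintype.sum_prod_type]
  refine Finset.sum_congr rfl fun a _ => ?_
  by_cases h : f a = b
  · simp [h, Fin.consEquiv, List.ofFn_succ, coeff_rename, coeff_tail]
  · simp [h, Fin.consEquiv, List.ofFn_succ]

theorem rename_one : rename f (1 : NCSeries X K) = 1 := by
  classical
  refine ext_tail (coeff_nil_rename f _) fun b => ?_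
  rw [tail_rename, tail_one]
  simp [tail_one]

theorem rename_mul (u u' : NCSeries X K) : rename f (u * u') = rename f u * rename f u' := by
  classical
  ext w
  induction w generalizing u u' with
  | nil => simp only [coeff_nil_mul, coeff_nil_rename]
  | cons b w ih =>
    rw [← coeff_tail, ← coeff_tail, tail_rename, tail_mul, tail_rename, tail_rename,
      coeff_nil_rename, Finset.sum_mul, Finset.smul_sum, ← Finset.sum_add_distrib, coeff_sum,
      coeff_sum]
    refine Finset.sum_congr rfl fun a _ => ?_
    split_ifs
    · rw [tail_mul, map_add, map_smul, coeff_add, coeff_add, ih]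
    · simp

/-- Renaming variables, as a homomorphism of algebras. -/
def renameHom : NCSeries X K →ₐ[K] NCSeries Y K :=
  AlgHom.ofLinearMap (rename f) (rename_one f) (rename_mul f)

theorem rename_var (x : X) : rename f (var K x) = var K (f x) := by
  classical
  refine ext_tail (by rw [coeff_nil_rename, coeff_nil_var, coeff_nil_var]) fun b => ?_
  rw [tail_rename, tail_var, Finset.sum_eq_single x]
  · simp [tail_var, rename_one, eq_comm]
  · intro a _ ha
    simp [tail_var, ha]
  · simp

theorem rename_mem_ord {N : ℕ} {u : NCSeries X K} (hu : u ∈ ord (K := K) N) :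
    rename f u ∈ ord (K := K) N := by
  classical
  intro w hw
  rw [coeff_rename]
  refine Finset.sum_eq_zero fun g _ => ?_
  rw [hu _ (by simpa using hw), ite_self]

end Rename

variable (K) in
/-- The series in `n` and in `2 n` free variables. -/
def seriesDouble (n : ℕ) :
    SeriesDouble K (NCSeries (Fin n) K) (NCSeries (Fin n ⊕ Fin n) K) (Fin n) where
  z := var K
  y := var K
  left := renameHom Sum.inl
  right := renameHom Sum.inr
  fold := renameHom (Sum.elim id id)
  der := der
  left_z := rename_var _
  right_z := rename_var _
  fold_inl _ := rename_var _ _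
  fold_inr _ := rename_var _ _
  der_mul := der_mul
  der_y := der_var
  left_mem _ _ := rename_mem_ord _
  right_mem _ _ := rename_mem_ord _
  fold_mem _ _ := rename_mem_ord _
  der_mem _ _ _ hv _ := der_mem_ord hv
  mem_ord_zero := mem_ord_zero
  isDense_z := isDense_var _ _
  isDense_y := isDense_var _ _
  isSeparated_left := isSeparated _ _
  isSeparated_right := isSeparated _ _

/-- Coefficients of `H_{[m]}` are coefficients of `t^m` in those of `H_t`, so the order bound in `z`
is inherited. -/
theorem IsExpansion.mem_ord {n α : ℕ} {W : Set ℕ+} {F : Fin n → NCSeries (Fin n) (PowerSeries K)}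
    {H : W → Fin n → NCSeries (Fin n) K} (hH : IsExpansion F H) (hF : IsFormalAut α F) (m : W)
    (i : Fin n) : H m i ∈ ord (K := K) α := fun w hw => by
  rw [← hH.coeff_mem i w m, hF.order_ge i w hw, map_zero]

end NCSeries

/-! ### Commutative series -/

namespace MvPowerSeries
variable {K : Type*} [CommRing K] {X Y : Type*}

theorem mem_ord {N : ℕ} {u : MvPowerSeries X K} :
    u ∈ ord (K := K) N ↔ ∀ d : X →₀ ℕ, d.degree < N → coeff d u = 0 := Iff.rfl

theorem mem_ord_zero (u : MvPowerSeries X K) : u ∈ ord (K := K) 0 :=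
  mem_ord.2 fun _ h => absurd h (by simp)

variable (X K) in
theorem isSeparated : IsSeparated K (MvPowerSeries X K) := fun _ hu =>
  ext fun d => hu (d.degree + 1) d (Nat.lt_succ_self _)

variable (X K) in
theorem isDense_X [Finite X] : IsDense K (MvPowerSeries.X : X → MvPowerSeries X K) := by
  intro N u
  refine ⟨(truncTotal N u : MvPolynomial X K), ?_, fun d hd => ?_⟩
  · generalize truncTotal N u = p
    induction p using MvPolynomial.induction_on with
    | C r => rw [MvPolynomial.coe_C]; exact Subalgebra.algebraMap_mem _ r
    | add p q hp hq => rw [MvPolynomial.coe_add]; exact Subalgebra.add_mem _ hp hq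
    | mul_X p x hp =>
      rw [MvPolynomial.coe_mul, MvPolynomial.coe_X]
      exact Subalgebra.mul_mem _ hp (Algebra.subset_adjoin ⟨x, rfl⟩)
  · rw [map_sub, MvPolynomial.coeff_coe, coeff_truncTotal _ hd, sub_self]

theorem mul_mem_ord {M N : ℕ} {u v : MvPowerSeries X K} (hu : u ∈ ord (K := K) M)
    (hv : v ∈ ord (K := K) N) : u * v ∈ ord (K := K) (M + N) := by
  classical
  intro d hd
  rw [coeff_mul]
  refine Finset.sum_eq_zero fun p hp => ?_
  have h : p.1.degree + p.2.degree = d.degree := by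
    rw [← Finset.HasAntidiagonal.mem_antidiagonal.1 hp, map_add]
  by_cases hp1 : p.1.degree < M
  · rw [hu _ hp1, zero_mul]
  · rw [hv _ (by omega), mul_zero]

theorem pderiv_mem_ord (x : X) {N : ℕ} {u : MvPowerSeries X K} (hu : u ∈ ord (K := K) N) :
    pderiv K x u ∈ ord (K := K) (N - 1) := by
  intro d hd
  rw [coeff_pderiv, hu _ (by rw [map_add, Finsupp.degree_single]; omega), zero_mul]

theorem rename_mem_ord [Finite X] (f : X → Y) {N : ℕ} {u : MvPowerSeries X K}
    (hu : u ∈ ord (K := K) N) : rename f u ∈ ord (K := K) N := by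
  intro d hd
  rw [coeff_rename]
  refine Finset.sum_eq_zero fun e he => hu e ?_
  -- Identifying variables preserves the total degree of a monomial.
  have he : Finsupp.mapDomain f e = d := by simpa using he
  rwa [← he, Finsupp.degree_mapDomain] at hd

section VectorField
variable [Fintype X] (v : X → MvPowerSeries X K)

theorem vectorField_apply (u : MvPowerSeries X K) :
    vectorField v u = ∑ x, v x * pderiv K x u := by
  simp [vectorField, LinearMap.sum_apply]

theorem vectorField_mul (u u' : MvPowerSeries X K) :
    vectorField v (u * u') = vectorField v u * u' + u * vectorField v u' := by
  simp only [vectorField_apply, Finset.sum_mul, Finset.mul_sum, ← Finset.sum_add_distrib]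
  refine Finset.sum_congr rfl fun x _ => ?_
  rw [Derivation.leibniz, smul_eq_mul, smul_eq_mul]
  ring

theorem vectorField_X (x : X) : vectorField v (MvPowerSeries.X x) = v x := by
  classical
  rw [vectorField_apply, Finset.sum_eq_single x]
  · rw [pderiv_X_self, mul_one]
  · intro y _ hy
    rw [pderiv_X_of_ne hy.symm, mul_zero]
  · simp

theorem vectorField_mem_ord {α N : ℕ} {v : X → MvPowerSeries X K}
    (hv : ∀ x, v x ∈ ord (K := K) α) {u : MvPowerSeries X K} (hu : u ∈ ord (K := K) N) :
    vectorField v u ∈ ord (K := K) (N + α - 1) := by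
  rw [vectorField_apply]
  -- The product has order at least `α + (N - 1)`, which is at least `N + α - 1` also for `N = 0`,
  -- where the subtraction truncates.
  exact Submodule.sum_mem _ fun x _ =>
    antitone_ord (a := N + α - 1) (by omega) (mul_mem_ord (hv x) (pderiv_mem_ord x hu))

end VectorField

variable (K) in
/-- The series in `n` and in `2 n` commuting variables. -/
def seriesDouble (n : ℕ) :
    SeriesDouble K (MvPowerSeries (Fin n) K) (MvPowerSeries (Fin n ⊕ Fin n) K) (Fin n) where
  z := MvPowerSeries.X
  y := MvPowerSeries.X
  left := rename Sum.inl
  right := rename Sum.inr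
  fold := rename (Sum.elim id id)
  der := vectorField
  left_z := rename_X _
  right_z := rename_X _
  fold_inl _ := rename_X _ _
  fold_inr _ := rename_X _ _
  der_mul := vectorField_mul
  der_y := vectorField_X
  left_mem _ _ := rename_mem_ord _
  right_mem _ _ := rename_mem_ord _
  fold_mem _ _ := rename_mem_ord _
  der_mem _ _ _ hv _ := vectorField_mem_ord hv
  mem_ord_zero := mem_ord_zero
  isDense_z := isDense_X _ _
  isDense_y := isDense_X _ _
  isSeparated_left := isSeparated _ _
  isSeparated_right := isSeparated _ _

theorem IsExpansion.mem_ord {n α : ℕ} {W : Set ℕ+}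
    {F : Fin n → MvPowerSeries (Fin n) (PowerSeries K)} {H : W → Fin n → MvPowerSeries (Fin n) K}
    (hH : IsExpansion F H) (hF : IsFormalAut α F) (m : W) (i : Fin n) :
    H m i ∈ ord (K := K) α := fun d hd => by
  rw [← hH.coeff_mem i d m, hF.order_ge i d hd, map_zero]

end MvPowerSeries

end

/-! ### The theorem for both kinds of variables -/

theorem theorem3p1 {K : Type*} [CommRing K] [Algebra ℚ K] (n α : ℕ) (hα : 1 ≤ α)
    (W : Set ℕ+) (hW : W.Nonempty) :
    -- noncommutative variables
    (∀ (F : Fin n → NCSeries (Fin n) (PowerSeries K)) (H : W → Fin n → NCSeries (Fin n) K),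
      NCSeries.IsFormalAut α F → NCSeries.IsExpansion F H →
      ∃ A : HGL K W →ₗ[K] diffOp K (NCSeries (Fin n) K) α,
        (∀ T : PlaneForest W, (A (HGL.of K (Forest.mk T)) : Module.End K (NCSeries (Fin n) K)) =
          treeOp NCSeries.bPlus H T) ∧ IsHopfHom A) ∧
    -- commutative variables
    (∀ (F : Fin n → MvPowerSeries (Fin n) (PowerSeries K))
      (H : W → Fin n → MvPowerSeries (Fin n) K),
      MvPowerSeries.IsFormalAut α F → MvPowerSeries.IsExpansion F H →
      ∃ A : HGL K W →ₗ[K] diffOp K (MvPowerSeries (Fin n) K) α,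
        (∀ T : PlaneForest W,
          (A (HGL.of K (Forest.mk T)) : Module.End K (MvPowerSeries (Fin n) K)) =
            treeOp MvPowerSeries.bPlus H T) ∧ IsHopfHom A) := by
  refine ⟨fun F H hF hH => ?_, fun F H hF hH => ?_⟩
  -- The operation `B_+` of the double unfolds to `NCSeries.bPlus`, so the operators agree by
  -- definition; likewise in the commutative case.
  · exact (NCSeries.seriesDouble K n).exists_isHopfHom H hα fun a i => hH.mem_ord hF a i
  · exact (MvPowerSeries.seriesDouble K n).exists_isHopfHom H hα fun a i => hH.mem_ord hF a i
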